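/- Let $\Omega=(a,b)$ be a non-empty bounded open interval in $\mathbb R$ with Lebesgue measure $\lambda$, so $\lambda(\Omega)=b-a$. For $s\ge 0$ and $f\in L^2(\Omega)$ let $$\|f\|_{s,2}^2=\sum_{0\le\alpha\le\lfloor s\rfloor}\int_\Omega |f^{(\alpha)}|^2\,d\lambda+\int_\Omega\int_\Omega\frac{|f^{(\lfloor s\rfloor)}(x)-f^{(\lfloor s\rfloor)}(y)|^2}{|x-y|^{1+2(s-\lfloor s\rfloor)}}\,d\lambda(x)\,d\lambda(y),$$ where derivatives are weak derivatives, the double integral is omitted when $s$ is an integer, and $\|f\|_{s,2}=\infty$ if one of these weak derivatives does not exist. For $s>1/2$ let $\mathsf W_2^s(\Omega)$ be the space of bounded continuous $f:\Omega\to\mathbb R$ with $\|f\|_{s,2}<\infty$. Write $\|f\|_\Omega=\sup_{x\in\Omega}|f(x)|$. Fix $t>1/2$, $\zeta\ge 0$ and $D>0$ with $\zeta<\lambda(\Omega)^{-1}<D^2$, and put $$\mathcal P(t,\zeta,D)=\Big\{p\in\mathsf W_2^t(\Omega):\int_\Omega p\,d\lambda=1,\ \inf_{x\in\Omega}p(x)\ge\zeta,\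 \|p\|_{t,2}\le D\Big\}.$$ For $x_1,\dots,x_n\in\Omega$, an NPML-estimator is an element $p$ of $\mathcal P(t,\zeta,D)$ that maximizes $\frac1n\sum_{i=1}^n\log p(x_i)$ over $\mathcal P(t,\zeta,D)$, with $\log 0=-\infty$. Let $X_1,X_2,\dots$ be i.i.d. random variables with values in $\Omega$ and common law $\mathbb P$. Let $\Theta\subseteq\mathbb R^m$ be non-empty and compact, let $p_\theta$, $\theta\in\Theta$, be probability densities on $\Omega$, let $(V,\mathcal V,\mu)$ be a probability space and let $\rho:V\times\Theta\to\Omega$ be measurable in its first argument and such that, for every $\theta\in\Theta$, the law of $\rho(\cdot,\theta)$ under $\mu$ has density $p_\theta$. Let $V_1,V_2,\dots$ be i.i.d. random variables with values in $V$ and common law $\mu$. Then an NPML-estimator exists for all $n\ge1$ and all $x_1,\dots,x_n\in\Omega$. Let $\hat p_n$ denote an NPML-estimator for $X_1,\dots,X_n$ (a function of these data), and let $\tilde p_k(\theta)$ denote an NPML-estimator for the simulated data $\rho(V_1,\theta),\dots,\rho(V_k,\theta)$ (a function of $\theta$ and $V_1,\dots,V_k$). For every such choice of estimators the following hold. (a)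 If $\mathbb P$ has a density $p_\blacktriangle\in\mathcal P(t,\zeta,D)$, then $\lim_{n\to\infty}\|\hat p_n-p_\blacktriangle\|_{s,2}=0$ almost surely for every $s$ with $0\le s<t$; in particular, $\lim_{n\to\infty}\|\hat p_n-p_\blacktriangle\|_\Omega=0$ almost surely. (b) If $p_\theta\in\mathcal P(t,\zeta,D)$ for a given $\theta\in\Theta$, then, for this $\theta$, $\lim_{k\to\infty}\|\tilde p_k(\theta)-p_\theta\|_{s,2}=0$ almost surely for every $s$ with $0\le s<t$; in particular, $\lim_{k\to\infty}\|\tilde p_k(\theta)-p_\theta\|_\Omega=0$ almost surely. (c) If $p_\theta\in\mathcal P(t,\zeta,D)$ for every $\theta\in\Theta$, $\inf_{x\in\Omega,\theta\in\Theta}p_\theta(x)>0$, and $\theta\mapsto\rho(v,\theta)$ is continuous on $\Theta$ for every $v\in V$, then $\lim_{k\to\infty}\sup_{\theta\in\Theta}\|\tilde p_k(\theta)-p_\theta\|_{s,2}=0$ almost surely for every $s$ with $0\le s<t$; in particular, $\lim_{k\to\infty}\sup_{\theta\in\Theta}\|\tilde p_k(\theta)-p_\theta\|_\Omega=0$ almost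 surely. -/

import Mathlib

open Set MeasureTheory ProbabilityTheory Filter Topology
open scoped ENNReal ContDiff

namespace NPML

/-- The bounded open interval `(a, b)` as a type, with its Borel `σ`-field. -/
abbrev Dom (a b : ℝ) : Type := ↥(Set.Ioo a b)

/-- Lebesgue measure on `(a, b)`. -/
noncomputable def leb (a b : ℝ) : Measure (Dom a b) := Measure.comap Subtype.val volume

variable {a b : ℝ}

/-- `g` is a weak derivative of order `α` of `f` on `(a, b)`: both functions are locally integrable
and `∫ f φ⁽ᵅ⁾ = (-1)ᵅ ∫ g φ` for all smooth `φ` with compact support contained in `(a, b)`. -/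
def IsWeakDeriv (α : ℕ) (f g : Dom a b → ℝ) : Prop :=
  LocallyIntegrable f (leb a b) ∧ LocallyIntegrable g (leb a b) ∧
    ∀ φ : ℝ → ℝ, ContDiff ℝ ∞ φ → HasCompactSupport φ → tsupport φ ⊆ Set.Ioo a b →
      ∫ x, f x * iteratedDeriv α φ x ∂(leb a b) = (-1) ^ α * ∫ x, g x * φ x ∂(leb a b)

open Classical in
/-- The weak derivative of order `α` (unique up to null sets); zero if there is none. -/
noncomputable def weakDeriv (α : ℕ) (f : Dom a b → ℝ) : Dom a b → ℝ :=
  if h : ∃ g, IsWeakDeriv α f g then h.choose else 0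

/-- The double integral of `(g x - g y)² / |x - y|^(1 + 2σ)`. -/
noncomputable def gagliardo (σ : ℝ) (g : Dom a b → ℝ) : ℝ≥0∞ :=
  ∫⁻ y, ∫⁻ x, ENNReal.ofReal ((g x - g y) ^ 2 / |(x : ℝ) - (y : ℝ)| ^ (1 + 2 * σ))
    ∂(leb a b) ∂(leb a b)

open Classical in
/-- The Sobolev norm `‖f‖_{s,2}` of order `s ≥ 0`, with values in `[0, ∞]`. It is infinite if one
of the weak derivatives of order at most `⌊s⌋` does not exist. -/
noncomputable def sobolevNorm (s : ℝ) (f : Dom a b → ℝ) : ℝ≥0∞ :=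
  if ∀ α ≤ ⌊s⌋₊, ∃ g, IsWeakDeriv α f g then
    ((∑ α ∈ Finset.range (⌊s⌋₊ + 1), ∫⁻ x, ‖weakDeriv α f x‖ₑ ^ 2 ∂(leb a b)) +
      (if s = (⌊s⌋₊ : ℝ) then 0 else gagliardo (s - (⌊s⌋₊ : ℝ)) (weakDeriv ⌊s⌋₊ f)))
      ^ (1 / 2 : ℝ)
  else ⊤

/-- The sup-norm on `(a, b)`, with values in `[0, ∞]`. -/
noncomputable def supNorm (f : Dom a b → ℝ) : ℝ≥0∞ := ⨆ x, ‖f x‖ₑ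

/-- The Sobolev space of bounded continuous functions with finite `‖·‖_{s,2}` (for `s > 1/2`). -/
def sobolevSpace (a b s : ℝ) : Set (Dom a b → ℝ) :=
  {f | Continuous f ∧ (∃ C : ℝ, ∀ x, |f x| ≤ C) ∧ sobolevNorm s f < ⊤}

/-- The set `𝒫(t, ζ, D)` of probability densities on `(a, b)`. -/
def densities (a b t ζ D : ℝ) : Set (Dom a b → ℝ) :=
  {p | p ∈ sobolevSpace a b t ∧ ∫ x, p x ∂(leb a b) = 1 ∧ (∀ x, ζ ≤ p x) ∧
    sobolevNorm t p ≤ ENNReal.ofReal D}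

/-- The log-likelihood `n⁻¹ ∑ log p(xᵢ)` in `[-∞, ∞)`, with `log 0 = -∞` (for `p ≥ 0`). -/
noncomputable def logLik {n : ℕ} (x : Fin n → Dom a b) (p : Dom a b → ℝ) : EReal :=
  (((n : ℝ)⁻¹ : ℝ) : EReal) * ∑ i, ENNReal.log (ENNReal.ofReal (p (x i)))

/-- `p` is an NPML-estimator over `𝒫(t, ζ, D)` for the data points `x₁, …, xₙ`. -/
def IsNPML (t ζ D : ℝ) {n : ℕ} (x : Fin n → Dom a b) (p : Dom a b → ℝ) : Prop :=
  p ∈ densities a b t ζ D ∧ logLik x p = ⨆ q ∈ densities a b t ζ D, logLik x q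

/-- The measurable non-negative function `p` is a density of `P` with respect to Lebesgue
measure. -/
def IsDensity (P : Measure (Dom a b)) (p : Dom a b → ℝ) : Prop :=
  Measurable p ∧ (∀ x, 0 ≤ p x) ∧ P = (leb a b).withDensity (fun x => ENNReal.ofReal (p x))

end NPML

/-!
Hölder continuity of functions of finite `t`-norm, `t > 1/2`, makes the set `𝒫` of admissible
densities equicontinuous; a uniform limit of members of `𝒫` stays in `𝒫`, because a sequence of
nearly minimal `t`-norm is Cauchy by the parallelogram identity. So `𝒫` is compact for the uniform
norm, and maximizers of the likelihood exist.

If `q` is an estimator for data with density `p ∈ 𝒫`, then `(q + p) / 2 ∈ 𝒫` has at most the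
likelihood of `q`, and `log x ≤ x - 1` turns this into a bound `≤ 1` for the average of
`2p / (q + p)` at the data. These functions are bounded, so that the strong law of large numbers,
applied to random elements of the separable Banach space `C(T, ℝ)` with `T` compact, holds uniformly
over `q ∈ 𝒫` and, in (c), over `θ ∈ Θ`. On the other hand `∫ 2p² / (q + p) ≥ 1`, with equality only
for `q = p`. By compactness the estimators converge uniformly, and interpolation between the uniform
norm and the bounded `t`-norm gives convergence in the `s`-norm for `s < t`.
-/

namespace NPML

variable {a b : ℝ}

section Lebesgue

theorem leb_preimage_val (s : Set ℝ) : leb a b (Subtype.val ⁻¹' s) = volume (s ∩ Ioo a b) := by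
  rw [leb, comap_subtype_coe_apply measurableSet_Ioo, Subtype.image_preimage_coe, inter_comm]

theorem leb_univ : leb a b univ = ENNReal.ofReal (b - a) := by
  simpa using leb_preimage_val (a := a) (b := b) univ

theorem leb_preimage_Ioo {x y : ℝ} (hx : a ≤ x) (hy : y ≤ b) :
    leb a b (Subtype.val ⁻¹' (Ioo x y)) = ENNReal.ofReal (y - x) := by
  rw [leb_preimage_val, inter_eq_left.2 (Ioo_subset_Ioo hx hy), Real.volume_Ioo]

instance : IsFiniteMeasure (leb a b) := ⟨by simp [leb_univ]⟩

instance : (leb a b).IsOpenPosMeasure :=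
  Measure.IsOpenPosMeasure.comap _ isOpen_Ioo.isOpenEmbedding_subtypeVal

theorem map_val_leb : (leb a b).map Subtype.val = volume.restrict (Ioo a b) := by
  rw [leb, map_comap_subtype_coe measurableSet_Ioo]

theorem lintegral_leb (f : ℝ → ℝ≥0∞) : ∫⁻ x, f x ∂(leb a b) = ∫⁻ x in Ioo a b, f x :=
  lintegral_subtype_comap measurableSet_Ioo f

theorem integral_leb (f : ℝ → ℝ) : ∫ x, f x ∂(leb a b) = ∫ x in Ioo a b, f x :=
  integral_subtype_comap measurableSet_Ioo f

theorem isCompact_preimage_val {K : Set ℝ} (hK : IsCompact K) (hKab : K ⊆ Ioo a b) :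
    IsCompact (Subtype.val ⁻¹' K : Set (Dom a b)) :=
  Topology.IsInducing.subtypeVal.isCompact_preimage' hK (by rwa [Subtype.range_coe])

end Lebesgue

section TestFunctions

/-- The test functions on `(a, b)`: smooth functions with compact support contained in `(a, b)`. -/
structure IsTest (a b : ℝ) (φ : ℝ → ℝ) : Prop where
  contDiff : ContDiff ℝ ∞ φ
  hasCompactSupport : HasCompactSupport φ
  tsupport_subset : tsupport φ ⊆ Ioo a b

namespace IsTest

variable {φ ψ : ℝ → ℝ}

protected theorem deriv (h : IsTest a b φ) : IsTest a b (deriv φ) where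
  contDiff := (contDiff_infty_iff_deriv.1 h.contDiff).2
  hasCompactSupport := h.hasCompactSupport.deriv
  tsupport_subset := tsupport_deriv_subset.trans h.tsupport_subset

protected theorem iteratedDeriv (h : IsTest a b φ) (α : ℕ) : IsTest a b (iteratedDeriv α φ) := by
  induction α with
  | zero => simpa using h
  | succ α ih => simpa only [iteratedDeriv_succ] using ih.deriv

theorem add (h : IsTest a b φ) (h' : IsTest a b ψ) : IsTest a b (φ + ψ) where
  contDiff := h.contDiff.add h'.contDiff
  hasCompactSupport := h.hasCompactSupport.add h'.hasCompactSupport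
  tsupport_subset := (tsupport_add φ ψ).trans (union_subset h.tsupport_subset h'.tsupport_subset)

theorem const_smul (h : IsTest a b φ) (c : ℝ) : IsTest a b (c • φ) where
  contDiff := h.contDiff.const_smul c
  hasCompactSupport := h.hasCompactSupport.smul_left (f := fun _ => c)
  tsupport_subset := (closure_mono (Function.support_const_smul_subset c φ)).trans
    h.tsupport_subset

theorem continuous (h : IsTest a b φ) : Continuous φ := h.contDiff.continuous

theorem hasDerivAt (h : IsTest a b φ) (x : ℝ) : HasDerivAt φ (deriv φ x) x :=
  (h.contDiff.differentiable (by simp) x).hasDerivAt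

theorem eq_zero (h : IsTest a b φ) {x : ℝ} (hx : x ∉ Ioo a b) : φ x = 0 :=
  image_eq_zero_of_notMem_tsupport fun hx' => hx (h.tsupport_subset hx')

theorem exists_bound (h : IsTest a b φ) : ∃ C, ∀ x, |φ x| ≤ C :=
  h.hasCompactSupport.exists_bound_of_continuous h.continuous

theorem integrable (h : IsTest a b φ) : Integrable φ :=
  h.continuous.integrable_of_hasCompactSupport h.hasCompactSupport

theorem integral_leb_eq (h : IsTest a b φ) : ∫ x, φ x ∂(leb a b) = ∫ x, φ x := by
  rw [integral_leb]
  exact setIntegral_eq_integral_of_forall_compl_eq_zero fun x hx => h.eq_zero hx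

theorem integrable_mul (h : IsTest a b φ) {f : Dom a b → ℝ}
    (hf : LocallyIntegrable f (leb a b)) : Integrable (fun x => f x * φ x) (leb a b) := by
  have hsupp : HasCompactSupport fun x : Dom a b => φ x :=
    HasCompactSupport.of_support_subset_isCompact
      (isCompact_preimage_val h.hasCompactSupport h.tsupport_subset)
      fun x hx => subset_tsupport φ hx
  simpa only [smul_eq_mul, mul_comm, Function.comp_apply] using
    hf.integrable_smul_left_of_hasCompactSupport (h.continuous.comp continuous_subtype_val) hsupp

end IsTest

theorem ae_eq_zero_of_forall_isTest {h : Dom a b → ℝ} (hh : LocallyIntegrable h (leb a b))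
    (H : ∀ φ, IsTest a b φ → ∫ x, h x * φ x ∂(leb a b) = 0) : h =ᵐ[leb a b] 0 := by
  have hval : MeasurableEmbedding (Subtype.val : Dom a b → ℝ) :=
    MeasurableEmbedding.subtype_coe measurableSet_Ioo
  set h' : ℝ → ℝ := Function.extend Subtype.val h 0
  have h'_val (x : Dom a b) : h' x = h x := Subtype.val_injective.extend_apply _ _ _
  have hloc : LocallyIntegrableOn h' (Ioo a b) volume := by
    rw [locallyIntegrableOn_iff isOpen_Ioo.isLocallyClosed]
    intro K hKab hK
    have h1 : IntegrableOn h' K (volume.restrict (Ioo a b)) := by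
      rw [← map_val_leb, hval.integrableOn_map_iff]
      exact (hh.integrableOn_isCompact (isCompact_preimage_val hK hKab)).congr
        (ae_of_all _ fun x => (h'_val x).symm)
    rwa [IntegrableOn, Measure.restrict_restrict hK.measurableSet, inter_eq_left.2 hKab] at h1
  have h'_zero : ∀ᵐ x, x ∈ Ioo a b → h' x = 0 :=
    isOpen_Ioo.ae_eq_zero_of_integral_contDiff_smul_eq_zero hloc fun φ hφ hφ' hφab => by
      have hφt : IsTest a b φ := ⟨hφ, hφ', hφab⟩
      calc ∫ x, φ x • h' x = ∫ x in Ioo a b, φ x • h' x :=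
            (setIntegral_eq_integral_of_forall_compl_eq_zero
              fun x hx => by rw [hφt.eq_zero hx, zero_smul]).symm
        _ = ∫ x, h x * φ x ∂(leb a b) := by
            rw [← integral_leb]
            simp only [h'_val, smul_eq_mul, mul_comm]
        _ = 0 := H φ hφt
  rw [← ae_restrict_iff' measurableSet_Ioo, ← map_val_leb, hval.ae_map_iff] at h'_zero
  exact h'_zero.mono fun x hx => (h'_val x).symm.trans hx

end TestFunctions

section WeakDerivatives

variable {α : ℕ} {f f' g g' : Dom a b → ℝ}

theorem isWeakDeriv_iff : IsWeakDeriv α f g ↔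
    LocallyIntegrable f (leb a b) ∧ LocallyIntegrable g (leb a b) ∧ ∀ φ, IsTest a b φ →
      ∫ x, f x * iteratedDeriv α φ x ∂(leb a b) = (-1) ^ α * ∫ x, g x * φ x ∂(leb a b) :=
  ⟨fun h => ⟨h.1, h.2.1, fun φ hφ => h.2.2 φ hφ.1 hφ.2 hφ.3⟩,
    fun h => ⟨h.1, h.2.1, fun φ h1 h2 h3 => h.2.2 φ ⟨h1, h2, h3⟩⟩⟩

namespace IsWeakDeriv

theorem integral_eq (h : IsWeakDeriv α f g) {φ : ℝ → ℝ} (hφ : IsTest a b φ) :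
    ∫ x, f x * iteratedDeriv α φ x ∂(leb a b) = (-1) ^ α * ∫ x, g x * φ x ∂(leb a b) :=
  (isWeakDeriv_iff.1 h).2.2 φ hφ

theorem ae_eq (h : IsWeakDeriv α f g) (h' : IsWeakDeriv α f g') : g =ᵐ[leb a b] g' := by
  have hsub : g - g' =ᵐ[leb a b] 0 :=
    ae_eq_zero_of_forall_isTest (h.2.1.sub h'.2.1) fun φ hφ => by
      simp only [Pi.sub_apply, sub_mul]
      rw [integral_sub (hφ.integrable_mul h.2.1) (hφ.integrable_mul h'.2.1), sub_eq_zero]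
      exact mul_left_cancel₀ (pow_ne_zero _ (by norm_num))
        ((h.integral_eq hφ).symm.trans (h'.integral_eq hφ))
  exact hsub.mono fun x hx => sub_eq_zero.1 hx

theorem congr_right (h : IsWeakDeriv α f g) (hg : g =ᵐ[leb a b] g') : IsWeakDeriv α f g' := by
  refine isWeakDeriv_iff.2 ⟨h.1, h.2.1.congr hg, fun φ hφ => (h.integral_eq hφ).trans ?_⟩
  congr 1
  exact integral_congr_ae (hg.mono fun x hx => by simp only [hx])

theorem add (h : IsWeakDeriv α f g) (h' : IsWeakDeriv α f' g') :
    IsWeakDeriv α (f + f') (g + g') := by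
  refine isWeakDeriv_iff.2 ⟨h.1.add h'.1, h.2.1.add h'.2.1, fun φ hφ => ?_⟩
  have hφα := hφ.iteratedDeriv α
  simp only [Pi.add_apply, add_mul]
  rw [integral_add (hφα.integrable_mul h.1) (hφα.integrable_mul h'.1),
    integral_add (hφ.integrable_mul h.2.1) (hφ.integrable_mul h'.2.1),
    h.integral_eq hφ, h'.integral_eq hφ, mul_add]

theorem const_smul (h : IsWeakDeriv α f g) (c : ℝ) : IsWeakDeriv α (c • f) (c • g) := by
  refine isWeakDeriv_iff.2 ⟨h.1.smul c, h.2.1.smul c, fun φ hφ => ?_⟩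
  simp only [Pi.smul_apply, smul_eq_mul, mul_assoc, integral_const_mul, h.integral_eq hφ]
  ring

theorem sub (h : IsWeakDeriv α f g) (h' : IsWeakDeriv α f' g') :
    IsWeakDeriv α (f - f') (g - g') := by
  simpa only [neg_smul, one_smul, ← sub_eq_add_neg] using h.add (h'.const_smul (-1))

theorem of_succ (h : IsWeakDeriv α f g) (h' : IsWeakDeriv (α + 1) f f') :
    IsWeakDeriv 1 g f' := by
  refine isWeakDeriv_iff.2 ⟨h.2.1, h'.2.1, fun φ hφ => ?_⟩
  have hpow : (-1 : ℝ) ^ α ≠ 0 := pow_ne_zero _ (by norm_num)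
  have key := (h.integral_eq hφ.deriv).symm.trans
    ((iteratedDeriv_succ' (n := α) (f := φ)) ▸ h'.integral_eq hφ)
  rw [pow_succ, mul_assoc] at key
  simpa only [iteratedDeriv_one, pow_one] using mul_left_cancel₀ hpow key

end IsWeakDeriv

theorem isWeakDeriv_zero (hf : LocallyIntegrable f (leb a b)) : IsWeakDeriv 0 f f :=
  ⟨hf, hf, fun φ _ _ _ => by simp⟩

theorem isWeakDeriv_const (c : ℝ) (α : ℕ) :
    IsWeakDeriv α (fun _ : Dom a b => c) (fun _ => if α = 0 then c else 0) := by
  refine isWeakDeriv_iff.2 ⟨locallyIntegrable_const _, locallyIntegrable_const _, fun φ hφ => ?_⟩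
  rcases α with _ | α
  · simp
  · have hφα := hφ.iteratedDeriv α
    have hzero : ∫ x, iteratedDeriv (α + 1) φ x = 0 := by
      rw [iteratedDeriv_succ]
      exact integral_eq_zero_of_hasDerivAt_of_integrable hφα.hasDerivAt hφα.deriv.integrable
        hφα.integrable
    simp [integral_const_mul, (hφ.iteratedDeriv (α + 1)).integral_leb_eq, hzero]

end WeakDerivatives

section Energy

section SquareIntegrals

variable {X E : Type*} [MeasurableSpace X] {μ : Measure X} [NormedAddCommGroup E]
  [InnerProductSpace ℝ E]

theorem enorm_sq_parallelogram (y z : E) :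
    ‖y + z‖ₑ ^ 2 + ‖y - z‖ₑ ^ 2 = 2 * (‖y‖ₑ ^ 2 + ‖z‖ₑ ^ 2) := by
  simp only [← ofReal_norm, ← ENNReal.ofReal_pow (norm_nonneg _), ← ENNReal.ofReal_ofNat 2]
  rw [← ENNReal.ofReal_add (by positivity) (by positivity),
    ← ENNReal.ofReal_add (by positivity) (by positivity), ← ENNReal.ofReal_mul (by positivity)]
  rw [parallelogram_law_with_norm ℝ]

theorem enorm_add_sq_le (y z : E) : ‖y + z‖ₑ ^ 2 ≤ 2 * (‖y‖ₑ ^ 2 + ‖z‖ₑ ^ 2) :=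
  le_self_add.trans_eq (enorm_sq_parallelogram y z)

theorem enorm_sub_sq_le (y z : E) : ‖y - z‖ₑ ^ 2 ≤ 2 * (‖y‖ₑ ^ 2 + ‖z‖ₑ ^ 2) :=
  le_add_self.trans_eq (enorm_sq_parallelogram y z)

theorem lintegral_enorm_sq_parallelogram {u v : X → E} (hu : AEStronglyMeasurable u μ)
    (hv : AEStronglyMeasurable v μ) :
    ∫⁻ x, ‖(u + v) x‖ₑ ^ 2 ∂μ + ∫⁻ x, ‖(u - v) x‖ₑ ^ 2 ∂μ =
      2 * (∫⁻ x, ‖u x‖ₑ ^ 2 ∂μ + ∫⁻ x, ‖v x‖ₑ ^ 2 ∂μ) := by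
  rw [← lintegral_add_left' ((hu.add hv).enorm.pow_const 2),
    ← lintegral_add_left' (hu.enorm.pow_const 2), ← lintegral_const_mul' _ _ ENNReal.ofNat_ne_top]
  simp only [Pi.add_apply, Pi.sub_apply, enorm_sq_parallelogram]

end SquareIntegrals

theorem lintegral_enorm_sq_const_smul {X E : Type*} [MeasurableSpace X] {μ : Measure X}
    [NormedAddCommGroup E] [NormedSpace ℝ E] (c : ℝ) (u : X → E) :
    ∫⁻ x, ‖(c • u) x‖ₑ ^ 2 ∂μ = ‖c‖ₑ ^ 2 * ∫⁻ x, ‖u x‖ₑ ^ 2 ∂μ := by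
  rw [← lintegral_const_mul' _ _ (by finiteness)]
  simp only [Pi.smul_apply, enorm_smul, mul_pow]

/-- The fractional difference quotient `(g x - g y) / |x - y|^(1/2 + σ)`. It is linear in `g`, and
its squared `L²` norm on the square is the Gagliardo seminorm. -/
noncomputable def fracQuot (σ : ℝ) (g : Dom a b → ℝ) (p : Dom a b × Dom a b) : ℝ :=
  (g p.1 - g p.2) / |(p.1 : ℝ) - (p.2 : ℝ)| ^ (1 / 2 + σ)

section FracQuot

variable {σ : ℝ} {g h : Dom a b → ℝ}

theorem fracQuot_add : fracQuot σ (g + h) = fracQuot σ g + fracQuot σ h := by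
  ext p
  simp only [fracQuot, Pi.add_apply]
  ring

theorem fracQuot_sub : fracQuot σ (g - h) = fracQuot σ g - fracQuot σ h := by
  ext p
  simp only [fracQuot, Pi.sub_apply]
  ring

theorem fracQuot_const_smul (c : ℝ) : fracQuot σ (c • g) = c • fracQuot σ g := by
  ext p
  simp only [fracQuot, Pi.smul_apply, smul_eq_mul]
  ring

@[fun_prop]
theorem measurable_fracQuot (hg : Measurable g) : Measurable (fracQuot σ g) := by
  unfold fracQuot
  fun_prop

theorem enorm_fracQuot_sq (p : Dom a b × Dom a b) : ‖fracQuot σ g p‖ₑ ^ 2 =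
    ENNReal.ofReal ((g p.1 - g p.2) ^ 2 / |(p.1 : ℝ) - (p.2 : ℝ)| ^ (1 + 2 * σ)) := by
  rw [Real.enorm_eq_ofReal_abs, ← ENNReal.ofReal_pow (abs_nonneg _), sq_abs, fracQuot, div_pow,
    ← Real.rpow_mul_natCast (abs_nonneg _)]
  congr 3
  push_cast
  ring

theorem gagliardo_eq_lintegral_lintegral_fracQuot (σ : ℝ) (g : Dom a b → ℝ) :
    gagliardo σ g = ∫⁻ y, ∫⁻ x, ‖fracQuot σ g (x, y)‖ₑ ^ 2 ∂(leb a b) ∂(leb a b) := by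
  simp only [enorm_fracQuot_sq, gagliardo]

theorem gagliardo_eq_lintegral_fracQuot (hg : Measurable g) :
    gagliardo σ g = ∫⁻ p, ‖fracQuot σ g p‖ₑ ^ 2 ∂((leb a b).prod (leb a b)) := by
  rw [lintegral_prod_symm _ (by fun_prop), gagliardo_eq_lintegral_lintegral_fracQuot]

theorem gagliardo_congr (hgh : g =ᵐ[leb a b] h) : gagliardo σ g = gagliardo σ h :=
  lintegral_congr_ae (hgh.mono fun y hy => lintegral_congr_ae (hgh.mono fun x hx => by
    simp only [hx, hy]))

theorem gagliardo_parallelogram (hg : Measurable g) (hh : Measurable h) :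
    gagliardo σ (g + h) + gagliardo σ (g - h) = 2 * (gagliardo σ g + gagliardo σ h) := by
  rw [gagliardo_eq_lintegral_fracQuot (hg.add hh), gagliardo_eq_lintegral_fracQuot (hg.sub hh),
    gagliardo_eq_lintegral_fracQuot hg, gagliardo_eq_lintegral_fracQuot hh, fracQuot_add,
    fracQuot_sub]
  exact lintegral_enorm_sq_parallelogram (measurable_fracQuot hg).aestronglyMeasurable
    (measurable_fracQuot hh).aestronglyMeasurable

theorem gagliardo_const_smul (hg : Measurable g) (c : ℝ) :
    gagliardo σ (c • g) = ‖c‖ₑ ^ 2 * gagliardo σ g := by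
  rw [gagliardo_eq_lintegral_fracQuot (hg.const_smul c), gagliardo_eq_lintegral_fracQuot hg,
    fracQuot_const_smul, lintegral_enorm_sq_const_smul]

end FracQuot

/-- The square of the Sobolev norm of order `s` of a function with the weak derivatives
`G 0, …, G ⌊s⌋`. -/
noncomputable def energy (s : ℝ) (G : ℕ → Dom a b → ℝ) : ℝ≥0∞ :=
  (∑ α ∈ Finset.range (⌊s⌋₊ + 1), ∫⁻ x, ‖G α x‖ₑ ^ 2 ∂(leb a b)) +
    (if s = (⌊s⌋₊ : ℝ) then 0 else gagliardo (s - (⌊s⌋₊ : ℝ)) (G ⌊s⌋₊))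

variable {s : ℝ} {G H : ℕ → Dom a b → ℝ}

theorem lintegral_sq_le_energy {α : ℕ} (hα : α ≤ ⌊s⌋₊) :
    ∫⁻ x, ‖G α x‖ₑ ^ 2 ∂(leb a b) ≤ energy s G :=
  (Finset.single_le_sum (f := fun α => ∫⁻ x, ‖G α x‖ₑ ^ 2 ∂(leb a b)) (fun _ _ => zero_le)
    (Finset.mem_range.2 (Nat.lt_succ_of_le hα))).trans le_self_add

theorem gagliardo_le_energy (hs : s ≠ (⌊s⌋₊ : ℝ)) :
    gagliardo (s - (⌊s⌋₊ : ℝ)) (G ⌊s⌋₊) ≤ energy s G := by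
  rw [energy, if_neg hs]
  exact le_add_self

theorem energy_const_smul (hG : ∀ α, Measurable (G α)) (c : ℝ) :
    energy s (c • G) = ‖c‖ₑ ^ 2 * energy s G := by
  simp only [energy, Pi.smul_apply, mul_add, Finset.mul_sum, mul_ite, mul_zero,
    gagliardo_const_smul (hG _), ← lintegral_enorm_sq_const_smul]

theorem energy_parallelogram (hG : ∀ α, Measurable (G α)) (hH : ∀ α, Measurable (H α)) :
    energy s (G + H) + energy s (G - H) = 2 * (energy s G + energy s H) := by
  have hL2 (α : ℕ) := lintegral_enorm_sq_parallelogram (μ := leb a b)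
    (hG α).aestronglyMeasurable (hH α).aestronglyMeasurable
  simp only [energy, Pi.add_apply G, Pi.sub_apply G]
  rw [add_add_add_comm, ← Finset.sum_add_distrib, Finset.sum_congr rfl fun α _ => hL2 α,
    ← Finset.mul_sum, Finset.sum_add_distrib, add_add_add_comm (∑ _ ∈ _, _), mul_add 2 (_ + _)]
  congr 1
  split_ifs
  · simp
  · exact gagliardo_parallelogram (hG _) (hH _)

theorem energy_sub_le (hG : ∀ α, Measurable (G α)) (hH : ∀ α, Measurable (H α)) :
    energy s (G - H) ≤ 2 * (energy s G + energy s H) :=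
  le_add_self.trans_eq (energy_parallelogram hG hH)

theorem energy_add_le (hG : ∀ α, Measurable (G α)) (hH : ∀ α, Measurable (H α)) :
    energy s (G + H) ≤ 2 * (energy s G + energy s H) :=
  le_self_add.trans_eq (energy_parallelogram hG hH)

end Energy

section Jets

/-- `G 0, …, G n` are measurable weak derivatives of `f` of the orders `0, …, n`. -/
structure IsJet (n : ℕ) (f : Dom a b → ℝ) (G : ℕ → Dom a b → ℝ) : Prop where
  measurable : ∀ α, Measurable (G α)
  isWeakDeriv : ∀ α ≤ n, IsWeakDeriv α f (G α)

variable {s : ℝ} {n : ℕ} {f g : Dom a b → ℝ} {G H : ℕ → Dom a b → ℝ}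

namespace IsJet

theorem mono (h : IsJet n f G) {m : ℕ} (hm : m ≤ n) : IsJet m f G :=
  ⟨h.measurable, fun α hα => h.isWeakDeriv α (hα.trans hm)⟩

theorem add (hG : IsJet n f G) (hH : IsJet n g H) : IsJet n (f + g) (G + H) :=
  ⟨fun α => (hG.measurable α).add (hH.measurable α),
    fun α hα => (hG.isWeakDeriv α hα).add (hH.isWeakDeriv α hα)⟩

theorem sub (hG : IsJet n f G) (hH : IsJet n g H) : IsJet n (f - g) (G - H) :=
  ⟨fun α => (hG.measurable α).sub (hH.measurable α),
    fun α hα => (hG.isWeakDeriv α hα).sub (hH.isWeakDeriv α hα)⟩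

theorem const_smul (hG : IsJet n f G) (c : ℝ) : IsJet n (c • f) (c • G) :=
  ⟨fun α => (hG.measurable α).const_smul c, fun α hα => (hG.isWeakDeriv α hα).const_smul c⟩

theorem sobolevNorm_eq (h : IsJet ⌊s⌋₊ f G) : sobolevNorm s f = energy s G ^ (1 / 2 : ℝ) := by
  have hex : ∀ α ≤ ⌊s⌋₊, ∃ g, IsWeakDeriv α f g := fun α hα => ⟨_, h.isWeakDeriv α hα⟩
  have hw : ∀ α ≤ ⌊s⌋₊, weakDeriv α f =ᵐ[leb a b] G α := fun α hα => by
    rw [weakDeriv, dif_pos (hex α hα)]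
    exact (hex α hα).choose_spec.ae_eq (h.isWeakDeriv α hα)
  rw [sobolevNorm, if_pos hex, energy, gagliardo_congr (hw _ le_rfl)]
  congr 2
  refine Finset.sum_congr rfl fun α hα => lintegral_congr_ae ?_
  exact (hw α (Finset.mem_range_succ_iff.1 hα)).mono fun x hx => by simp only [hx]

theorem sobolevNorm_le_iff (h : IsJet ⌊s⌋₊ f G) {D : ℝ≥0∞} :
    sobolevNorm s f ≤ D ↔ energy s G ≤ D ^ 2 := by
  rw [h.sobolevNorm_eq, one_div, ENNReal.rpow_inv_le_iff (by norm_num), ENNReal.rpow_ofNat]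

end IsJet

theorem exists_isJet (hf : sobolevNorm s f < ⊤) : ∃ G, IsJet ⌊s⌋₊ f G := by
  have hex : ∀ α ≤ ⌊s⌋₊, ∃ g, IsWeakDeriv α f g := by
    by_contra hne
    rw [sobolevNorm, if_neg hne] at hf
    exact hf.false
  have hmeas (α : ℕ) : ∃ g : Dom a b → ℝ, Measurable g ∧ (α ≤ ⌊s⌋₊ → IsWeakDeriv α f g) := by
    by_cases hα : α ≤ ⌊s⌋₊
    · obtain ⟨g, hg⟩ := hex α hα
      have hm := hg.2.1.aestronglyMeasurable
      exact ⟨hm.mk g, hm.stronglyMeasurable_mk.measurable, fun _ => hg.congr_right hm.ae_eq_mk⟩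
    · exact ⟨0, measurable_zero, fun h => absurd h hα⟩
  choose G hG hG' using hmeas
  exact ⟨G, hG, hG'⟩

end Jets

section FundamentalTheorem

theorem exists_isTest_integral_eq_one (hab : a < b) :
    ∃ χ, IsTest a b χ ∧ ∫ x, χ x = 1 ∧ ∀ x, 0 ≤ χ x ∧ χ x ≤ 2 / (b - a) := by
  let B : ContDiffBump ((a + b) / 2) := ⟨(b - a) / 4, 3 * (b - a) / 8, by linarith, by linarith⟩
  refine ⟨B.normed volume, ⟨B.contDiff_normed, B.hasCompactSupport_normed, ?_⟩, B.integral_normed,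
    fun x => ⟨B.nonneg_normed x, ?_⟩⟩
  · rw [B.tsupport_normed_eq, Real.closedBall_eq_Icc]
    refine Icc_subset_Ioo ?_ ?_ <;> dsimp only [B] <;> linarith
  · refine (B.normed_le_div_measure_closedBall_rIn volume x).trans_eq ?_
    rw [Real.volume_real_closedBall B.rIn_pos.le]
    dsimp only [B]
    field_simp
    norm_num

theorem intervalIntegral_eq_zero_of_notMem_Icc {θ : ℝ → ℝ} {c d x : ℝ}
    (hθ : ∀ y ∉ Icc c d, θ y = 0) (h0 : ∫ y, θ y = 0) (hx : x ∉ Icc c d) :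
    ∫ y in c..x, θ y = 0 := by
  rcases lt_or_ge x c with hlt | hge
  · rw [intervalIntegral.integral_of_ge hlt.le, integral_Ioc_eq_integral_Ioo,
      setIntegral_eq_zero_of_forall_eq_zero fun y hy => hθ y fun hy' => hy.2.not_ge hy'.1, neg_zero]
  · have hdx : d < x := lt_of_not_ge fun hxd => hx ⟨hge, hxd⟩
    rw [intervalIntegral.integral_of_le hge, ← integral_Icc_eq_integral_Ioc,
      setIntegral_eq_integral_of_forall_compl_eq_zero, h0]
    exact fun y hy => hθ y fun hy' => hy ⟨hy'.1, hy'.2.trans hdx.le⟩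

theorem IsTest.exists_deriv_eq {θ : ℝ → ℝ} (h : IsTest a b θ) (h0 : ∫ x, θ x = 0) :
    ∃ ψ, IsTest a b ψ ∧ deriv ψ = θ := by
  rcases (tsupport θ).eq_empty_or_nonempty with hempty | hne
  · obtain rfl : θ = 0 := tsupport_eq_empty_iff.1 hempty
    exact ⟨0, h, deriv_zero⟩
  obtain ⟨c, hc⟩ := h.hasCompactSupport.exists_isLeast hne
  obtain ⟨d, hd⟩ := h.hasCompactSupport.exists_isGreatest hne
  set ψ : ℝ → ℝ := fun x => ∫ t in c..x, θ t
  have hψ (x : ℝ) : HasDerivAt ψ (θ x) x :=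
    intervalIntegral.integral_hasDerivAt_right (h.continuous.intervalIntegrable _ _)
      h.continuous.stronglyMeasurable.stronglyMeasurableAtFilter h.continuous.continuousAt
  have hψ' : deriv ψ = θ := funext fun x => (hψ x).deriv
  have hθ : ∀ x ∉ Icc c d, θ x = 0 := fun x hx =>
    image_eq_zero_of_notMem_tsupport fun hx' => hx ⟨hc.2 hx', hd.2 hx'⟩
  have hsupp : Function.support ψ ⊆ Icc c d := fun x hx => by
    by_contra hx'
    exact hx (intervalIntegral_eq_zero_of_notMem_Icc hθ h0 hx')
  refine ⟨ψ, ⟨?_, .of_support_subset_isCompact isCompact_Icc hsupp, ?_⟩, hψ'⟩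
  · rw [contDiff_infty_iff_deriv, hψ']
    exact ⟨fun x => (hψ x).differentiableAt, h.contDiff⟩
  · exact (closure_minimal hsupp isClosed_Icc).trans
      (Icc_subset_Ioo (h.tsupport_subset hc.1).1 (h.tsupport_subset hd.1).2)

theorem ae_eq_const_of_forall_isTest_deriv (hab : a < b) {h : Dom a b → ℝ}
    (hh : LocallyIntegrable h (leb a b))
    (H : ∀ ψ, IsTest a b ψ → ∫ x, h x * deriv ψ x ∂(leb a b) = 0) :
    ∃ c, h =ᵐ[leb a b] fun _ => c := by
  obtain ⟨χ, hχ, hχ1, -⟩ := exists_isTest_integral_eq_one hab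
  set c := ∫ x, h x * χ x ∂(leb a b) with hc
  have hcloc : LocallyIntegrable (fun _ : Dom a b => c) (leb a b) := locallyIntegrable_const c
  suffices hzero : h - (fun _ => c) =ᵐ[leb a b] 0 from ⟨c, hzero.mono fun x hx => sub_eq_zero.1 hx⟩
  refine ae_eq_zero_of_forall_isTest (hh.sub hcloc) fun φ hφ => ?_
  -- `φ - (∫ φ) χ` has mean zero, hence is the derivative of a test function.
  obtain ⟨ψ, hψ, hψ'⟩ := (hφ.add (hχ.const_smul (-∫ x, φ x))).exists_deriv_eq (by
    simp only [Pi.add_apply, Pi.smul_apply, smul_eq_mul]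
    rw [integral_add hφ.integrable (hχ.integrable.const_mul _), integral_const_mul, hχ1]
    ring)
  have hψh := H ψ hψ
  have hsplit (x : Dom a b) : h x * (φ + (-∫ x, φ x) • χ) x =
      h x * φ x + (-∫ x, φ x) * (h x * χ x) := by
    simp only [Pi.add_apply, Pi.smul_apply, smul_eq_mul]
    ring
  simp_rw [hψ', hsplit] at hψh
  rw [integral_add (hφ.integrable_mul hh) ((hχ.integrable_mul hh).const_mul _),
    integral_const_mul, ← hc] at hψh
  simp only [Pi.sub_apply, sub_mul]
  rw [integral_sub (hφ.integrable_mul hh) (hφ.integrable_mul hcloc), integral_const_mul,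
    hφ.integral_leb_eq]
  linarith

section Primitive

variable {X : Type*} [MeasurableSpace X] [TopologicalSpace X] [LinearOrder X]
  [OrderClosedTopology X] [SecondCountableTopology X] [OpensMeasurableSpace X] {μ : Measure X}
  {u g : X → ℝ}

theorem integrable_indicator_lt_mul (hu : Integrable u μ) (hg : Integrable g μ) :
    Integrable ({p : X × X | p.2 < p.1}.indicator fun p => u p.1 * g p.2) (μ.prod μ) :=
  (hu.mul_prod hg).indicator (measurableSet_lt measurable_snd measurable_fst)

theorem integrable_setIntegral_Iio [IsFiniteMeasure μ] (hg : Integrable g μ) :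
    Integrable (fun x => ∫ z in Iio x, g z ∂μ) μ := by
  refine (integrable_indicator_lt_mul (integrable_const (1 : ℝ)) hg).integral_prod_left.congr
    (ae_of_all _ fun x => ?_)
  simp only [← integral_indicator measurableSet_Iio, one_mul]
  exact integral_congr_ae (ae_of_all _ fun z => by simp [indicator])

theorem integral_setIntegral_Iio_mul [SFinite μ] (hu : Integrable u μ) (hg : Integrable g μ) :
    ∫ x, (∫ z in Iio x, g z ∂μ) * u x ∂μ = ∫ z, g z * ∫ x in Ioi z, u x ∂μ ∂μ := by
  have hswap := integral_integral_swap
    (f := fun x z => {p : X × X | p.2 < p.1}.indicator (fun p => u p.1 * g p.2) (x, z))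
    (integrable_indicator_lt_mul hu hg)
  convert hswap using 2 with x z
  · ext x
    rw [mul_comm, ← integral_const_mul, ← integral_indicator measurableSet_Iio]
    exact integral_congr_ae (ae_of_all _ fun z => by simp [indicator])
  · ext z
    rw [← integral_const_mul, ← integral_indicator measurableSet_Ioi]
    exact integral_congr_ae (ae_of_all _ fun x => by simp [indicator, mul_comm])

end Primitive

theorem integrable_of_continuous_bdd {f : Dom a b → ℝ} (hf : Continuous f) {C : ℝ}
    (hC : ∀ x, |f x| ≤ C) : Integrable f (leb a b) :=
  .of_bound hf.aestronglyMeasurable C (ae_of_all _ hC)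

theorem IsTest.setIntegral_Ioi_deriv {φ : ℝ → ℝ} (hφ : IsTest a b φ) (z : Dom a b) :
    ∫ x in Ioi z, deriv φ x ∂(leb a b) = -φ z := by
  have hind (x : Dom a b) : (Ioi z).indicator (fun x : Dom a b => deriv φ x) x =
      (Ioi (z : ℝ)).indicator (deriv φ) x := by simp [indicator]
  rw [← integral_indicator measurableSet_Ioi]
  simp_rw [hind]
  rw [integral_leb, setIntegral_eq_integral_of_forall_compl_eq_zero
    fun x hx => by simp [indicator, hφ.deriv.eq_zero hx], integral_indicator measurableSet_Ioi,
    hφ.hasCompactSupport.integral_Ioi_deriv_eq (hφ.contDiff.of_le (by simp))]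

theorem isWeakDeriv_setIntegral_Iio {g : Dom a b → ℝ} (hg : Integrable g (leb a b)) :
    IsWeakDeriv 1 (fun x => ∫ z in Iio x, g z ∂(leb a b)) g := by
  refine isWeakDeriv_iff.2
    ⟨(integrable_setIntegral_Iio hg).locallyIntegrable, hg.locallyIntegrable, fun φ hφ => ?_⟩
  obtain ⟨C, hC⟩ := hφ.deriv.exists_bound
  have hφ' : Integrable (fun x : Dom a b => deriv φ x) (leb a b) :=
    integrable_of_continuous_bdd (hφ.deriv.continuous.comp continuous_subtype_val) fun x => hC x
  simp only [iteratedDeriv_one]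
  rw [integral_setIntegral_Iio_mul hφ' hg]
  simp only [hφ.setIntegral_Ioi_deriv, mul_neg, integral_neg, pow_one, neg_mul, one_mul]

theorem IsWeakDeriv.exists_ae_eq_add_setIntegral (hab : a < b) {w g : Dom a b → ℝ}
    (h : IsWeakDeriv 1 w g) (hg : Integrable g (leb a b)) :
    ∃ c, ∀ᵐ x ∂(leb a b), w x = c + ∫ z in Iio x, g z ∂(leb a b) := by
  have hsub := h.sub (isWeakDeriv_setIntegral_Iio hg)
  obtain ⟨c, hc⟩ := ae_eq_const_of_forall_isTest_deriv hab hsub.1 fun ψ hψ => by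
    simpa using hsub.integral_eq hψ
  exact ⟨c, hc.mono fun x hx => eq_add_of_sub_eq hx⟩

end FundamentalTheorem

section SquareIntegrable

variable {X : Type*} [MeasurableSpace X] {μ : Measure X}

theorem sq_lintegral_le {g : X → ℝ≥0∞} (hg : AEMeasurable g μ) :
    (∫⁻ x, g x ∂μ) ^ 2 ≤ μ univ * ∫⁻ x, g x ^ 2 ∂μ := by
  have holder := ENNReal.lintegral_mul_le_Lp_mul_Lq μ Real.HolderConjugate.two_two
    (aemeasurable_const (b := (1 : ℝ≥0∞))) hg
  simp only [Pi.mul_apply, one_mul, ENNReal.rpow_ofNat, one_pow, lintegral_one] at holder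
  calc (∫⁻ x, g x ∂μ) ^ 2 ≤ (μ univ ^ (1 / 2 : ℝ) * (∫⁻ x, g x ^ 2 ∂μ) ^ (1 / 2 : ℝ)) ^ 2 := by
        gcongr
    _ = μ univ * ∫⁻ x, g x ^ 2 ∂μ := by
        rw [← ENNReal.mul_rpow_of_nonneg _ _ (by norm_num), ← ENNReal.rpow_mul_natCast]
        norm_num

theorem integrable_of_lintegral_sq_lt_top [IsFiniteMeasure μ] {g : X → ℝ}
    (hm : AEStronglyMeasurable g μ) (hg : ∫⁻ x, ‖g x‖ₑ ^ 2 ∂μ < ⊤) : Integrable g μ := by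
  refine MemLp.integrable one_le_two ⟨hm, ?_⟩
  rw [eLpNorm_lt_top_iff_lintegral_rpow_enorm_lt_top two_ne_zero ENNReal.ofNat_ne_top]
  simpa using hg

end SquareIntegrable

section GagliardoOfWeakDeriv

instance : NullSingletonClass (leb a b) := by
  refine ⟨fun x => ?_⟩
  rw [leb, comap_subtype_coe_apply measurableSet_Ioo, image_singleton]
  exact measure_singleton _

theorem leb_Ioo (x y : Dom a b) : leb a b (Ioo x y) = ENNReal.ofReal ((y : ℝ) - x) :=
  leb_preimage_Ioo x.2.1.le y.2.2.le

theorem lintegral_abs_rpow_lt_top {r : ℝ} (hr : -1 < r) (L : ℝ) :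
    ∫⁻ x in Ioc (-L) L, ENNReal.ofReal (|x| ^ r) < ⊤ := by
  have h := (intervalIntegral.intervalIntegrable_cpow' (a := -L) (b := L)
    (r := (r : ℂ)) (by simpa using hr)).norm.1
  simp only [Complex.norm_cpow_real, Complex.norm_real, Real.norm_eq_abs] at h
  exact h.lintegral_lt_top

theorem exists_lintegral_dist_rpow_le {r : ℝ} (hr : -1 < r) :
    ∃ K : ℝ≥0∞, K < ⊤ ∧ ∀ z : Dom a b,
      ∫⁻ x : Dom a b, ENNReal.ofReal (|(x : ℝ) - z| ^ r) ∂(leb a b) ≤ K := by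
  refine ⟨_, lintegral_abs_rpow_lt_top hr (b - a), fun z => ?_⟩
  rw [lintegral_leb fun x => ENNReal.ofReal (|x - z| ^ r), ← lintegral_indicator measurableSet_Ioo,
    ← lintegral_indicator measurableSet_Ioc]
  refine le_trans ?_ (lintegral_sub_right_eq_self _ (z : ℝ)).le
  refine lintegral_mono fun x => ?_
  by_cases hx : x ∈ Ioo a b
  · have hxz : x - z ∈ Ioc (-(b - a)) (b - a) :=
      ⟨by linarith [hx.1, z.2.2], by linarith [hx.2, z.2.1]⟩
    rw [indicator_of_mem hx, indicator_of_mem hxz]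
  · simp [hx]

theorem enorm_setIntegral_Iio_sub_le {g : Dom a b → ℝ} (hg : Integrable g (leb a b))
    {x y : Dom a b} (hxy : x ≤ y) :
    ‖(∫ z in Iio y, g z ∂(leb a b)) - ∫ z in Iio x, g z ∂(leb a b)‖ₑ ≤
      ∫⁻ z in Ioo x y, ‖g z‖ₑ ∂(leb a b) := by
  rw [← Iio_union_Ico_eq_Iio hxy, setIntegral_union _ measurableSet_Ico hg.integrableOn
    hg.integrableOn, add_sub_cancel_left, setLIntegral_congr Ioo_ae_eq_Ico]
  · exact enorm_integral_le_lintegral_enorm _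
  · exact disjoint_left.2 fun z hz hz' => absurd hz (not_lt.2 hz'.1)

theorem ofReal_sq_div_eq {c d σ : ℝ} (hd : 0 < d) : ENNReal.ofReal (c ^ 2 / d ^ (1 + 2 * σ)) =
    ‖c‖ₑ ^ 2 * (ENNReal.ofReal d)⁻¹ * ENNReal.ofReal (d ^ (-σ)) ^ 2 := by
  rw [Real.enorm_eq_ofReal_abs, ← ENNReal.ofReal_inv_of_pos hd,
    ← ENNReal.ofReal_pow (abs_nonneg c), ← ENNReal.ofReal_pow (by positivity), sq_abs,
    ← ENNReal.ofReal_mul (sq_nonneg c), ← ENNReal.ofReal_mul (by positivity),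
    ← Real.rpow_mul_natCast hd.le, Real.rpow_add hd, Real.rpow_one, mul_assoc, div_eq_mul_inv,
    mul_inv, ← Real.rpow_neg hd.le]
  congr 4
  push_cast
  ring

theorem ofReal_sq_setIntegral_sub_div_le {g : Dom a b → ℝ} (hm : Measurable g)
    (hg : Integrable g (leb a b)) {σ : ℝ} (hσ : 0 ≤ σ) {x y : Dom a b} (hxy : x < y) :
    ENNReal.ofReal (((∫ z in Iio y, g z ∂(leb a b)) - ∫ z in Iio x, g z ∂(leb a b)) ^ 2 /
        |(y : ℝ) - x| ^ (1 + 2 * σ)) ≤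
      ∫⁻ z, ‖g z‖ₑ ^ 2 * ENNReal.ofReal (|(x : ℝ) - z| ^ (-σ)) *
        ENNReal.ofReal (|(y : ℝ) - z| ^ (-σ)) ∂(leb a b) := by
  have hpos : 0 < (y : ℝ) - x := sub_pos.2 hxy
  have cauchy_schwarz := sq_lintegral_le (μ := (leb a b).restrict (Ioo x y)) hm.enorm.aemeasurable
  rw [Measure.restrict_apply_univ, leb_Ioo] at cauchy_schwarz
  have hweight : ∀ z ∈ Ioo x y, ‖g z‖ₑ ^ 2 * ENNReal.ofReal (((y : ℝ) - x) ^ (-σ)) ^ 2 ≤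
      ‖g z‖ₑ ^ 2 * ENNReal.ofReal (|(x : ℝ) - z| ^ (-σ)) *
        ENNReal.ofReal (|(y : ℝ) - z| ^ (-σ)) := fun z hz => by
    have hxz : (x : ℝ) < z := hz.1
    have hzy : (z : ℝ) < y := hz.2
    rw [sq (ENNReal.ofReal _), mul_assoc, abs_of_pos (sub_pos.2 hzy), abs_of_neg (sub_neg.2 hxz)]
    gcongr ?_ * (ENNReal.ofReal ?_ * ENNReal.ofReal ?_)
    · rfl
    all_goals exact Real.rpow_le_rpow_of_nonpos (by linarith) (by linarith) (by linarith)
  rw [abs_of_pos hpos, ofReal_sq_div_eq hpos]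
  calc _ ≤ (ENNReal.ofReal ((y : ℝ) - x) * ∫⁻ z in Ioo x y, ‖g z‖ₑ ^ 2 ∂(leb a b)) *
          (ENNReal.ofReal ((y : ℝ) - x))⁻¹ * ENNReal.ofReal (((y : ℝ) - x) ^ (-σ)) ^ 2 := by
        gcongr
        exact (pow_le_pow_left' (enorm_setIntegral_Iio_sub_le hg hxy.le) 2).trans cauchy_schwarz
    _ = ∫⁻ z in Ioo x y, ‖g z‖ₑ ^ 2 * ENNReal.ofReal (((y : ℝ) - x) ^ (-σ)) ^ 2 ∂(leb a b) := by
        rw [mul_right_comm (ENNReal.ofReal _), ENNReal.mul_inv_cancel (by simpa using hpos)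
          ENNReal.ofReal_ne_top, one_mul, lintegral_mul_const _ (by fun_prop)]
    _ ≤ _ := (setLIntegral_mono' measurableSet_Ioo hweight).trans (setLIntegral_le_lintegral _ _)

theorem lintegral_lintegral_lintegral_mul_le {X : Type*} [MeasurableSpace X] {μ : Measure X}
    [SFinite μ] {f : X → ℝ≥0∞} (hf : Measurable f) {k : X → X → ℝ≥0∞}
    (hk : Measurable (Function.uncurry k)) {K : ℝ≥0∞} (hK : ∀ z, ∫⁻ x, k x z ∂μ ≤ K) :
    ∫⁻ y, ∫⁻ x, ∫⁻ z, f z * k x z * k y z ∂μ ∂μ ∂μ ≤ K * K * ∫⁻ z, f z ∂μ := by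
  have hk1 (z : X) : Measurable fun x => k x z := hk.comp measurable_prodMk_right
  have hk' : Measurable fun p : X × X => k p.1 p.2 := hk
  calc _ = ∫⁻ y, ∫⁻ z, ∫⁻ x, f z * k y z * k x z ∂μ ∂μ ∂μ := by
        refine lintegral_congr fun y => ?_
        have := hk.comp (measurable_const (a := y).prodMk measurable_id)
        simp only [Function.comp_def, Function.uncurry, id] at this
        simp only [mul_right_comm (f _) (k _ _) (k y _)]
        exact lintegral_lintegral_swap (by simp only [Function.uncurry_def]; fun_prop)
    _ ≤ ∫⁻ y, ∫⁻ z, f z * k y z * K ∂μ ∂μ := by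
        gcongr with y z
        rw [lintegral_const_mul _ (hk1 z)]
        gcongr
        exact hK z
    _ = ∫⁻ z, ∫⁻ y, f z * k y z * K ∂μ ∂μ :=
        lintegral_lintegral_swap (by simp only [Function.uncurry_def]; fun_prop)
    _ ≤ ∫⁻ z, f z * (K * K) ∂μ := by
        gcongr with z
        rw [lintegral_mul_const _ ((hk1 z).const_mul _), lintegral_const_mul _ (hk1 z), mul_assoc]
        gcongr
        exact hK z
    _ = K * K * ∫⁻ z, f z ∂μ := by rw [lintegral_mul_const _ hf, mul_comm]

theorem exists_gagliardo_le_of_isWeakDeriv (hab : a < b) {σ : ℝ} (h0 : 0 ≤ σ) (h1 : σ < 1) :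
    ∃ K : ℝ≥0∞, K < ⊤ ∧ ∀ w g : Dom a b → ℝ, Measurable g → IsWeakDeriv 1 w g →
      ∫⁻ x, ‖g x‖ₑ ^ 2 ∂(leb a b) < ⊤ → gagliardo σ w ≤ K * ∫⁻ x, ‖g x‖ₑ ^ 2 ∂(leb a b) := by
  obtain ⟨K, hK, hK'⟩ := exists_lintegral_dist_rpow_le (a := a) (b := b) (neg_lt_neg h1)
  refine ⟨K * K, ENNReal.mul_lt_top hK hK, fun w g hm hwg hfin => ?_⟩
  have hg := integrable_of_lintegral_sq_lt_top hm.aestronglyMeasurable hfin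
  obtain ⟨c, hc⟩ := hwg.exists_ae_eq_add_setIntegral hab hg
  have hpt : ∀ᵐ y ∂(leb a b), ∀ᵐ x ∂(leb a b),
      ENNReal.ofReal ((w x - w y) ^ 2 / |(x : ℝ) - y| ^ (1 + 2 * σ)) ≤
        ∫⁻ z, ‖g z‖ₑ ^ 2 * ENNReal.ofReal (|(x : ℝ) - z| ^ (-σ)) *
          ENNReal.ofReal (|(y : ℝ) - z| ^ (-σ)) ∂(leb a b) := by
    filter_upwards [hc] with y hy
    filter_upwards [hc] with x hx
    rw [hx, hy, add_sub_add_left_eq_sub]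
    rcases lt_trichotomy x y with hlt | rfl | hgt
    · rw [sub_sq_comm, abs_sub_comm]
      exact ofReal_sq_setIntegral_sub_div_le hm hg h0 hlt
    · simp
    · simpa only [mul_right_comm] using ofReal_sq_setIntegral_sub_div_le hm hg h0 hgt
  refine (lintegral_mono_ae (hpt.mono fun y hy => lintegral_mono_ae hy)).trans ?_
  refine lintegral_lintegral_lintegral_mul_le
    (k := fun x z : Dom a b => ENNReal.ofReal (|(x : ℝ) - z| ^ (-σ))) (by fun_prop) ?_ hK'
  simp only [Function.uncurry_def]
  fun_prop

end GagliardoOfWeakDeriv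

section Interpolation

section FracQuot

variable {σ σ' δ : ℝ} {g : Dom a b → ℝ} {p : Dom a b × Dom a b}

theorem fracQuot_eq_rpow_mul_fracQuot (σ σ' : ℝ) (g : Dom a b → ℝ) (p : Dom a b × Dom a b) :
    fracQuot σ' g p = |(p.1 : ℝ) - p.2| ^ (σ - σ') * fracQuot σ g p := by
  rcases eq_or_ne p.1 p.2 with heq | hne
  · simp [fracQuot, heq]
  · have hpos : 0 < |(p.1 : ℝ) - p.2| := abs_pos.2 (sub_ne_zero.2 (Subtype.coe_injective.ne hne))
    rw [fracQuot, fracQuot, mul_div_left_comm, ← Real.rpow_sub hpos, div_eq_mul_inv,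
      ← Real.rpow_neg hpos.le]
    ring_nf

theorem enorm_fracQuot_le_of_abs_sub_le (h : σ' ≤ σ) (hp : |(p.1 : ℝ) - p.2| ≤ δ) :
    ‖fracQuot σ' g p‖ₑ ≤ ENNReal.ofReal (δ ^ (σ - σ')) * ‖fracQuot σ g p‖ₑ := by
  rw [fracQuot_eq_rpow_mul_fracQuot σ, enorm_mul, Real.enorm_of_nonneg (by positivity)]
  gcongr

theorem enorm_fracQuot_le_of_le_abs_sub (hσ : 0 ≤ 1 / 2 + σ) (hδ : 0 < δ)
    (hp : δ ≤ |(p.1 : ℝ) - p.2|) :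
    ‖fracQuot σ g p‖ₑ ≤ ENNReal.ofReal (δ ^ (1 / 2 + σ))⁻¹ * ‖g p.1 - g p.2‖ₑ := by
  rw [fracQuot, div_eq_inv_mul, enorm_mul, Real.enorm_of_nonneg (by positivity)]
  gcongr

theorem enorm_sub_le_of_abs_sub_le (hσ : 0 ≤ 1 / 2 + σ) (hp : |(p.1 : ℝ) - p.2| ≤ δ) :
    ‖g p.1 - g p.2‖ₑ ≤ ENNReal.ofReal (δ ^ (1 / 2 + σ)) * ‖fracQuot σ g p‖ₑ := by
  have h := enorm_fracQuot_le_of_abs_sub_le (g := g) (σ := σ) (σ' := -(1 / 2)) (by linarith) hp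
  simpa [fracQuot, sub_neg_eq_add, add_comm] using h

end FracQuot

theorem lintegral_prod_add {X : Type*} [MeasurableSpace X] {μ : Measure X} [SFinite μ]
    {f : X → ℝ≥0∞} (hf : Measurable f) :
    ∫⁻ p : X × X, (f p.1 + f p.2) ∂(μ.prod μ) = 2 * μ univ * ∫⁻ x, f x ∂μ := by
  rw [lintegral_add_left (by fun_prop), lintegral_prod _ (by fun_prop),
    lintegral_prod _ (by fun_prop)]
  simp only [lintegral_const]
  rw [lintegral_mul_const _ hf]
  ring

theorem gagliardo_le_add {σ σ' δ : ℝ} (hσ' : 0 ≤ 1 / 2 + σ') (h : σ' ≤ σ) (hδ : 0 < δ)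
    {w : Dom a b → ℝ} (hw : Measurable w) :
    gagliardo σ' w ≤ ENNReal.ofReal (δ ^ (σ - σ')) ^ 2 * gagliardo σ w +
      ENNReal.ofReal (δ ^ (1 / 2 + σ'))⁻¹ ^ 2 *
        (4 * leb a b univ * ∫⁻ x, ‖w x‖ₑ ^ 2 ∂(leb a b)) := by
  have hpt (p : Dom a b × Dom a b) : ‖fracQuot σ' w p‖ₑ ^ 2 ≤
      ENNReal.ofReal (δ ^ (σ - σ')) ^ 2 * ‖fracQuot σ w p‖ₑ ^ 2 +
        ENNReal.ofReal (δ ^ (1 / 2 + σ'))⁻¹ ^ 2 * (2 * (‖w p.1‖ₑ ^ 2 + ‖w p.2‖ₑ ^ 2)) := by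
    rcases le_total |(p.1 : ℝ) - p.2| δ with hp | hp
    · refine le_add_right ?_
      rw [← mul_pow]
      gcongr
      exact enorm_fracQuot_le_of_abs_sub_le h hp
    · refine le_add_left ((pow_le_pow_left' (enorm_fracQuot_le_of_le_abs_sub hσ' hδ hp) 2).trans ?_)
      rw [mul_pow]
      gcongr
      exact enorm_sub_sq_le _ _
  rw [gagliardo_eq_lintegral_fracQuot hw, gagliardo_eq_lintegral_fracQuot hw]
  refine (lintegral_mono hpt).trans_eq ?_
  rw [lintegral_add_left (by fun_prop), lintegral_const_mul _ (by fun_prop),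
    lintegral_const_mul _ (by fun_prop), lintegral_const_mul _ (by fun_prop),
    lintegral_prod_add (f := fun x => ‖w x‖ₑ ^ 2) (by fun_prop)]
  ring

theorem IsTest.comp_sub_const {φ : ℝ → ℝ} {c : ℝ} (h : IsTest (a - c) (b - c) φ) :
    IsTest a b fun x => φ (x - c) where
  contDiff := h.contDiff.comp (contDiff_id.sub contDiff_const)
  hasCompactSupport := h.hasCompactSupport.comp_homeomorph (Homeomorph.subRight c)
  tsupport_subset := by
    refine (tsupport_comp_subset_preimage φ (continuous_id.sub continuous_const)).trans
      fun x hx => ?_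
    simpa using h.tsupport_subset hx

theorem IsTest.mono {a' b' : ℝ} {φ : ℝ → ℝ} (h : IsTest a b φ) (ha : a' ≤ a) (hb : b ≤ b') :
    IsTest a' b' φ :=
  ⟨h.contDiff, h.hasCompactSupport, h.tsupport_subset.trans (Ioo_subset_Ioo ha hb)⟩

/-- `φ` is a probability density that serves as a mollifier of width `δ` at the point `y`. -/
structure IsMollifierAt (δ y : ℝ) (φ : ℝ → ℝ) : Prop where
  nonneg : ∀ x, 0 ≤ φ x
  le_two_div : ∀ x, φ x ≤ 2 / δ
  abs_sub_le : ∀ x, φ x ≠ 0 → |x - y| ≤ δ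
  integral_eq_one : ∫ x, φ x = 1

theorem exists_uniform_isMollifierAt {δ : ℝ} (hδ : 0 < δ) (hδ' : δ ≤ b - a) (α : ℕ) :
    ∃ C, ∀ y ∈ Ioo a b, ∃ φ, IsTest a b φ ∧ IsMollifierAt δ y φ ∧
      ∀ x, |iteratedDeriv α φ x| ≤ C := by
  obtain ⟨χ, hχ, hχ1, hχ2⟩ := exists_isTest_integral_eq_one (a := -(δ / 2)) (b := δ / 2)
    (by linarith)
  obtain ⟨C, hC⟩ := (hχ.iteratedDeriv α).exists_bound
  refine ⟨C, fun y hy => ?_⟩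
  -- The centre `z` of the mollifier is `y`, moved away from the end points of the interval.
  obtain ⟨z, hzy, hza, hzb⟩ : ∃ z, |z - y| ≤ δ / 2 ∧ a + δ / 2 ≤ z ∧ z ≤ b - δ / 2 :=
    ⟨max (a + δ / 2) (min y (b - δ / 2)), by grind⟩
  refine ⟨fun x => χ (x - z), (hχ.mono (by linarith) (by linarith)).comp_sub_const, ?_, fun x => ?_⟩
  · refine ⟨fun x => (hχ2 _).1, fun x => (hχ2 _).2.trans_eq (by ring), fun x hx => ?_,
      (integral_sub_right_eq_self χ z).trans hχ1⟩
    obtain ⟨h1, h2⟩ : x - z ∈ Ioo (-(δ / 2)) (δ / 2) := by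
      by_contra hx'
      exact hx (hχ.eq_zero hx')
    rw [abs_le] at hzy ⊢
    constructor <;> linarith
  · rw [iteratedDeriv_comp_sub_const]
    exact hC _

section Mollify

variable {α : ℕ} {σ δ κ C : ℝ} {u w : Dom a b → ℝ} {φ : ℝ → ℝ} {y : Dom a b}

theorem IsWeakDeriv.enorm_integral_mul_le (huw : IsWeakDeriv α u w) (hφ : IsTest a b φ)
    (hu : ∀ x, |u x| ≤ κ) (hφC : ∀ x, |iteratedDeriv α φ x| ≤ C) :
    ‖∫ x, w x * φ x ∂(leb a b)‖ₑ ≤ ENNReal.ofReal (κ * C) * leb a b univ := by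
  have hflip : ‖∫ x, w x * φ x ∂(leb a b)‖ₑ = ‖∫ x, u x * iteratedDeriv α φ x ∂(leb a b)‖ₑ := by
    simp [huw.integral_eq hφ, enorm_mul]
  rw [hflip]
  refine (enorm_integral_le_lintegral_enorm _).trans ?_
  rw [← lintegral_const]
  refine lintegral_mono fun x => ?_
  rw [Real.enorm_eq_ofReal_abs, abs_mul]
  gcongr
  · exact (abs_nonneg _).trans (hu x)
  · exact hu x
  · exact hφC x

theorem IsMollifierAt.sub_integral_mul_eq (hφδ : IsMollifierAt δ y φ) (hφ : IsTest a b φ)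
    (hw : LocallyIntegrable w (leb a b)) :
    w y - ∫ x, w x * φ x ∂(leb a b) = ∫ x, (w y - w x) * φ x ∂(leb a b) := by
  simp_rw [sub_mul]
  rw [integral_sub (hφ.integrable_mul (locallyIntegrable_const _)) (hφ.integrable_mul hw),
    integral_const_mul, hφ.integral_leb_eq, hφδ.integral_eq_one, mul_one]

theorem leb_preimage_Icc_sub_add_le (y δ : ℝ) :
    leb a b (Subtype.val ⁻¹' Icc (y - δ) (y + δ)) ≤ ENNReal.ofReal (2 * δ) := by
  rw [leb_preimage_val]
  refine (measure_mono inter_subset_left).trans_eq ?_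
  rw [Real.volume_Icc]
  ring_nf

theorem IsMollifierAt.enorm_sub_mul_le (hφδ : IsMollifierAt δ y φ) (hσ : 0 ≤ 1 / 2 + σ)
    (hδ : 0 < δ) (x : Dom a b) :
    ‖(w y - w x) * φ x‖ₑ ≤ (Subtype.val ⁻¹' Icc (y - δ) (y + δ) : Set (Dom a b)).indicator
      (fun x => ENNReal.ofReal (2 / δ * δ ^ (1 / 2 + σ)) * ‖fracQuot σ w (x, y)‖ₑ) x := by
  by_cases hx : φ x = 0
  · simp [hx]
  have hxy := hφδ.abs_sub_le x hx
  have hxN : x ∈ Subtype.val ⁻¹' Icc (y - δ) (y + δ) := by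
    rw [abs_le] at hxy
    constructor <;> linarith
  rw [indicator_of_mem hxN, enorm_mul, mul_comm, ENNReal.ofReal_mul (by positivity), mul_assoc,
    Real.enorm_of_nonneg (hφδ.nonneg x), ← enorm_neg, neg_sub]
  exact mul_le_mul' (ENNReal.ofReal_le_ofReal (hφδ.le_two_div x))
    (enorm_sub_le_of_abs_sub_le (p := (x, y)) hσ hxy)

theorem IsMollifierAt.enorm_sub_integral_mul_sq_le (hφδ : IsMollifierAt δ y φ)
    (hφ : IsTest a b φ) (hσ : 0 ≤ 1 / 2 + σ) (hδ : 0 < δ) (hwm : Measurable w)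
    (hw : LocallyIntegrable w (leb a b)) :
    ‖w y - ∫ x, w x * φ x ∂(leb a b)‖ₑ ^ 2 ≤
      ENNReal.ofReal (8 * δ ^ (2 * σ)) * ∫⁻ x, ‖fracQuot σ w (x, y)‖ₑ ^ 2 ∂(leb a b) := by
  set N : Set (Dom a b) := Subtype.val ⁻¹' Icc (y - δ) (y + δ)
  have hNm : MeasurableSet N := measurable_subtype_coe measurableSet_Icc
  have hconst : (2 / δ * δ ^ (1 / 2 + σ)) ^ 2 * (2 * δ) = 8 * δ ^ (2 * σ) := by
    rw [mul_pow, ← Real.rpow_mul_natCast hδ.le, Nat.cast_ofNat, add_mul, Real.rpow_add hδ,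
      mul_comm σ]
    norm_num
    field_simp
    norm_num
  rw [hφδ.sub_integral_mul_eq hφ hw]
  calc ‖∫ x, (w y - w x) * φ x ∂(leb a b)‖ₑ ^ 2
      ≤ (∫⁻ x in N, ENNReal.ofReal (2 / δ * δ ^ (1 / 2 + σ)) * ‖fracQuot σ w (x, y)‖ₑ
          ∂(leb a b)) ^ 2 := by
        gcongr
        rw [← lintegral_indicator hNm]
        exact (enorm_integral_le_lintegral_enorm _).trans
          (lintegral_mono (hφδ.enorm_sub_mul_le hσ hδ))
    _ ≤ ENNReal.ofReal (2 * δ) * ∫⁻ x in N, (ENNReal.ofReal (2 / δ * δ ^ (1 / 2 + σ)) *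
          ‖fracQuot σ w (x, y)‖ₑ) ^ 2 ∂(leb a b) := by
        refine (sq_lintegral_le (by fun_prop)).trans ?_
        rw [Measure.restrict_apply_univ]
        gcongr
        exact leb_preimage_Icc_sub_add_le _ _
    _ ≤ ENNReal.ofReal (2 * δ) * ∫⁻ x, (ENNReal.ofReal (2 / δ * δ ^ (1 / 2 + σ)) *
          ‖fracQuot σ w (x, y)‖ₑ) ^ 2 ∂(leb a b) := by
        gcongr
        exact Measure.restrict_le_self
    _ = ENNReal.ofReal (8 * δ ^ (2 * σ)) * ∫⁻ x, ‖fracQuot σ w (x, y)‖ₑ ^ 2 ∂(leb a b) := by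
        simp only [mul_pow]
        rw [lintegral_const_mul _ (by fun_prop), ← mul_assoc, ← ENNReal.ofReal_pow (by positivity),
          ← ENNReal.ofReal_mul (by positivity), mul_comm (2 * δ), hconst]

theorem IsWeakDeriv.enorm_sq_le (huw : IsWeakDeriv α u w) (hφδ : IsMollifierAt δ y φ)
    (hφ : IsTest a b φ) (hσ : 0 ≤ 1 / 2 + σ) (hδ : 0 < δ) (hwm : Measurable w)
    (hu : ∀ x, |u x| ≤ κ) (hφC : ∀ x, |iteratedDeriv α φ x| ≤ C) :
    ‖w y‖ₑ ^ 2 ≤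
      ENNReal.ofReal (16 * δ ^ (2 * σ)) * ∫⁻ x, ‖fracQuot σ w (x, y)‖ₑ ^ 2 ∂(leb a b) +
        2 * (ENNReal.ofReal (κ * C) * leb a b univ) ^ 2 := by
  set A := ∫ x, w x * φ x ∂(leb a b)
  calc ‖w y‖ₑ ^ 2 = ‖(w y - A) + A‖ₑ ^ 2 := by rw [sub_add_cancel]
    _ ≤ 2 * ‖w y - A‖ₑ ^ 2 + 2 * ‖A‖ₑ ^ 2 := (enorm_add_sq_le _ _).trans_eq (mul_add _ _ _)
    _ ≤ 2 * (ENNReal.ofReal (8 * δ ^ (2 * σ)) *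
          ∫⁻ x, ‖fracQuot σ w (x, y)‖ₑ ^ 2 ∂(leb a b)) +
        2 * (ENNReal.ofReal (κ * C) * leb a b univ) ^ 2 := by
        gcongr
        · exact hφδ.enorm_sub_integral_mul_sq_le hφ hσ hδ hwm huw.2.1
        · exact huw.enorm_integral_mul_le hφ hu hφC
    _ = _ := by
        rw [← mul_assoc 2 (ENNReal.ofReal _), ← ENNReal.ofReal_ofNat 2,
          ← ENNReal.ofReal_mul (by norm_num)]
        ring_nf

end Mollify

theorem exists_lintegral_sq_le_gagliardo_add {σ δ : ℝ} (hσ : 0 ≤ 1 / 2 + σ) (hδ : 0 < δ)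
    (hδ' : δ ≤ b - a) (α : ℕ) :
    ∃ C : ℝ, ∀ (u w : Dom a b → ℝ) (κ : ℝ), Measurable w → IsWeakDeriv α u w → (∀ x, |u x| ≤ κ) →
      ∫⁻ x, ‖w x‖ₑ ^ 2 ∂(leb a b) ≤
        ENNReal.ofReal (16 * δ ^ (2 * σ)) * gagliardo σ w + ENNReal.ofReal (C * κ ^ 2) := by
  obtain ⟨C, hC⟩ := exists_uniform_isMollifierAt hδ hδ' α
  have hab : 0 ≤ b - a := hδ.le.trans hδ'
  refine ⟨2 * (C * (b - a)) ^ 2 * (b - a), fun u w κ hwm huw hu => ?_⟩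
  have hpt (y : Dom a b) : ‖w y‖ₑ ^ 2 ≤
      ENNReal.ofReal (16 * δ ^ (2 * σ)) * ∫⁻ x, ‖fracQuot σ w (x, y)‖ₑ ^ 2 ∂(leb a b) +
        2 * (ENNReal.ofReal (κ * C) * leb a b univ) ^ 2 := by
    obtain ⟨φ, hφ, hφδ, hφC⟩ := hC y y.2
    exact huw.enorm_sq_le hφδ hφ hσ hδ hwm hu hφC
  refine (lintegral_mono hpt).trans ?_
  rw [lintegral_add_right _ measurable_const, lintegral_const_mul' _ _ ENNReal.ofReal_ne_top,
    lintegral_const, ← gagliardo_eq_lintegral_lintegral_fracQuot, leb_univ]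
  gcongr
  calc 2 * (ENNReal.ofReal (κ * C) * ENNReal.ofReal (b - a)) ^ 2 * ENNReal.ofReal (b - a)
      ≤ ENNReal.ofReal 2 * (ENNReal.ofReal |κ * C| * ENNReal.ofReal (b - a)) ^ 2 *
          ENNReal.ofReal (b - a) := by
        rw [ENNReal.ofReal_ofNat]
        gcongr
        exact le_abs_self _
    _ = ENNReal.ofReal (2 * (C * (b - a)) ^ 2 * (b - a) * κ ^ 2) := by
        rw [← ENNReal.ofReal_mul (abs_nonneg _), ← ENNReal.ofReal_pow (by positivity),
          ← ENNReal.ofReal_mul zero_le_two, ← ENNReal.ofReal_mul (by positivity), mul_pow, sq_abs]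
        ring_nf

end Interpolation

section Campanato

theorem enorm_average_sq_le {X : Type*} [MeasurableSpace X] {μ : Measure X} {g : X → ℝ}
    (hg : AEMeasurable g μ) :
    ‖⨍ x, g x ∂μ‖ₑ ^ 2 ≤ (μ univ)⁻¹ * ∫⁻ x, ‖g x‖ₑ ^ 2 ∂μ := by
  set ν := (μ univ)⁻¹ • μ
  have hν : ν univ ≤ 1 := ENNReal.inv_mul_le_one _
  calc ‖⨍ x, g x ∂μ‖ₑ ^ 2 ≤ (∫⁻ x, ‖g x‖ₑ ∂ν) ^ 2 := by
        gcongr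
        exact enorm_integral_le_lintegral_enorm _
    _ ≤ ν univ * ∫⁻ x, ‖g x‖ₑ ^ 2 ∂ν := sq_lintegral_le (hg.smul_measure _).enorm
    _ ≤ ∫⁻ x, ‖g x‖ₑ ^ 2 ∂ν := mul_le_of_le_one_left' hν
    _ = (μ univ)⁻¹ * ∫⁻ x, ‖g x‖ₑ ^ 2 ∂μ := lintegral_smul_measure _ _

theorem setAverage_sub_setAverage {X : Type*} [MeasurableSpace X] {μ : Measure X}
    [IsFiniteMeasure μ] {f : X → ℝ} (hf : Integrable f μ) {I J : Set X} (hI : μ I ≠ 0)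
    (hJ : μ J ≠ 0) :
    (⨍ x in I, f x ∂μ) - ⨍ x in J, f x ∂μ = ⨍ p in I ×ˢ J, (f p.1 - f p.2) ∂(μ.prod μ) := by
  have hI' : μ.real I ≠ 0 := by simpa [measureReal_eq_zero_iff] using hI
  have hJ' : μ.real J ≠ 0 := by simpa [measureReal_eq_zero_iff] using hJ
  rw [setAverage_eq, setAverage_eq, setAverage_eq, ← Measure.prod_restrict,
    integral_sub (hf.integrableOn.comp_fst _) (hf.integrableOn.comp_snd _),
    integral_fun_fst, integral_fun_snd]
  simp only [measureReal_prod_prod, measureReal_restrict_apply_univ, smul_eq_mul]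
  field_simp

theorem enorm_setAverage_sub_setAverage_sq_le {σ ℓ : ℝ} (hσ : 0 ≤ 1 / 2 + σ) {f : Dom a b → ℝ}
    (hfm : Measurable f) (hfi : Integrable f (leb a b)) {I J : Set (Dom a b)}
    (hIm : MeasurableSet I) (hJm : MeasurableSet J) (hI : leb a b I ≠ 0) (hJ : leb a b J ≠ 0)
    (hℓ : ∀ x ∈ I, ∀ y ∈ J, |(x : ℝ) - y| ≤ ℓ) :
    ‖(⨍ x in I, f x ∂(leb a b)) - ⨍ x in J, f x ∂(leb a b)‖ₑ ^ 2 ≤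
      (leb a b I * leb a b J)⁻¹ * (ENNReal.ofReal (ℓ ^ (1 / 2 + σ)) ^ 2 * gagliardo σ f) := by
  rw [setAverage_sub_setAverage hfi hI hJ, gagliardo_eq_lintegral_fracQuot hfm,
    ← lintegral_const_mul _ (by fun_prop)]
  refine (enorm_average_sq_le (by fun_prop)).trans ?_
  rw [Measure.restrict_apply_univ, Measure.prod_prod]
  refine mul_le_mul_right ?_ _
  refine (setLIntegral_mono' (hIm.prod hJm) fun p hp => ?_).trans (setLIntegral_le_lintegral _ _)
  rw [← mul_pow]
  gcongr
  exact enorm_sub_le_of_abs_sub_le hσ (hℓ _ hp.1 _ hp.2)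

theorem tendsto_setAverage_of_continuousAt {X : Type*} [TopologicalSpace X] [MeasurableSpace X]
    {μ : Measure X} [IsFiniteMeasure μ] {f : X → ℝ} (hfi : Integrable f μ) {x : X}
    (hf : ContinuousAt f x) {I : ℕ → Set X} (hIm : ∀ n, MeasurableSet (I n))
    (hI : ∀ n, μ (I n) ≠ 0) (hIx : Tendsto I atTop (𝓝 x).smallSets) :
    Tendsto (fun n => ⨍ y in I n, f y ∂μ) atTop (𝓝 (f x)) := by
  refine (Metric.nhds_basis_closedBall.tendsto_right_iff).2 fun ε hε => ?_
  have hev := hIx.eventually (eventually_smallSets.2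
    ⟨_, hf (Metric.closedBall_mem_nhds _ hε), fun t ht => ht⟩)
  filter_upwards [hev] with n hn
  exact (convex_closedBall _ _).set_average_mem Metric.isClosed_closedBall (hI n)
    (measure_ne_top _ _) (ae_restrict_of_forall_mem (hIm n) fun y hy => hn hy) hfi.integrableOn

/-- The sets `I n` shrink geometrically to the point `x` of `(a, b)`, with the measures of intervals
of length `h / 2 ^ n`. -/
structure IsDyadicAt (h : ℝ) (x : Dom a b) (I : ℕ → Set (Dom a b)) : Prop where
  measurableSet : ∀ n, MeasurableSet (I n)
  leb_eq : ∀ n, leb a b (I n) = ENNReal.ofReal (h * 2⁻¹ ^ n)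
  abs_sub_le : ∀ n, ∀ y ∈ I n, |(y : ℝ) - x| ≤ h * 2⁻¹ ^ n

namespace IsDyadicAt

variable {σ M h : ℝ} {f : Dom a b → ℝ} {x : Dom a b} {I : ℕ → Set (Dom a b)}

theorem leb_ne_zero (hI : IsDyadicAt h x I) (hh : 0 < h) (n : ℕ) : leb a b (I n) ≠ 0 := by
  rw [hI.leb_eq, ENNReal.ofReal_ne_zero_iff]
  positivity

theorem tendsto_smallSets (hI : IsDyadicAt h x I) : Tendsto I atTop (𝓝 x).smallSets := by
  have hlim : Tendsto (fun n : ℕ => h * (2⁻¹ : ℝ) ^ n) atTop (𝓝 0) := by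
    simpa using (tendsto_pow_atTop_nhds_zero_of_lt_one (by norm_num : (0 : ℝ) ≤ 2⁻¹)
      (by norm_num)).const_mul h
  refine (Metric.nhds_basis_ball.smallSets.tendsto_right_iff).2 fun ε hε => ?_
  filter_upwards [hlim.eventually_lt_const hε] with n hn y hy
  exact (hI.abs_sub_le n y hy).trans_lt hn

theorem abs_setAverage_succ_sub_le (hI : IsDyadicAt h x I) (hσ : 0 ≤ 1 / 2 + σ) (hM : 0 ≤ M)
    (hh : 0 < h) (hfm : Measurable f) (hfi : Integrable f (leb a b))
    (hgag : gagliardo σ f ≤ ENNReal.ofReal (M ^ 2)) (n : ℕ) :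
    |(⨍ y in I n, f y ∂(leb a b)) - ⨍ y in I (n + 1), f y ∂(leb a b)| ≤
      2 ^ (1 + σ) * M * (h * 2⁻¹ ^ n) ^ (σ - 1 / 2) := by
  have hq : 0 < h * (2⁻¹ : ℝ) ^ n := by positivity
  have hdist : ∀ y ∈ I n, ∀ z ∈ I (n + 1), |(y : ℝ) - z| ≤ 2 * (h * 2⁻¹ ^ n) := fun y hy z hz => by
    have h1 := hI.abs_sub_le n y hy
    have h2 := hI.abs_sub_le (n + 1) z hz
    rw [pow_succ] at h2
    rw [abs_le] at *
    constructor <;> linarith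
  have hsq := enorm_setAverage_sub_setAverage_sq_le hσ hfm hfi (hI.measurableSet n)
    (hI.measurableSet (n + 1)) (hI.leb_ne_zero hh n) (hI.leb_ne_zero hh (n + 1)) hdist
  rw [hI.leb_eq, hI.leb_eq, pow_succ (2⁻¹ : ℝ), ← mul_assoc h] at hsq
  generalize h * (2⁻¹ : ℝ) ^ n = q at hsq hq ⊢
  have hconst : (q * (q * 2⁻¹))⁻¹ * (((2 * q) ^ (1 / 2 + σ)) ^ 2 * M ^ 2) =
      (2 ^ (1 + σ) * M * q ^ (σ - 1 / 2)) ^ 2 := by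
    have h2 : (2 : ℝ) ^ (1 + σ) = 2 ^ (1 / 2 + σ) * 2 ^ (1 / 2 : ℝ) := by
      rw [← Real.rpow_add two_pos]; ring_nf
    have hq' : q ^ (1 / 2 + σ) = q ^ (σ - 1 / 2) * q := by
      rw [← Real.rpow_add_one hq.ne']; ring_nf
    have hsqrt : ((2 : ℝ) ^ (1 / 2 : ℝ)) ^ 2 = 2 := by
      rw [← Real.sqrt_eq_rpow, Real.sq_sqrt zero_le_two]
    rw [Real.mul_rpow zero_le_two hq.le, h2, hq']
    simp only [mul_pow, hsqrt]
    field_simp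
  refine abs_le_of_sq_le_sq ?_ (by positivity)
  rw [← ENNReal.ofReal_le_ofReal_iff (by positivity), ← hconst, ← sq_abs,
    ENNReal.ofReal_pow (abs_nonneg _), ← Real.enorm_eq_ofReal_abs]
  calc _ ≤ (ENNReal.ofReal q * ENNReal.ofReal (q * 2⁻¹))⁻¹ *
        (ENNReal.ofReal ((2 * q) ^ (1 / 2 + σ)) ^ 2 * ENNReal.ofReal (M ^ 2)) := by
        refine hsq.trans ?_
        gcongr
    _ = _ := by
        rw [← ENNReal.ofReal_mul hq.le, ← ENNReal.ofReal_inv_of_pos (by positivity),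
          ← ENNReal.ofReal_pow (by positivity), ← ENNReal.ofReal_mul (by positivity),
          ← ENNReal.ofReal_mul (by positivity)]

theorem abs_setAverage_sub_le (hI : IsDyadicAt h x I) (hσ : 1 / 2 < σ) (hM : 0 ≤ M) (hh : 0 < h)
    (hf : Continuous f) (hfi : Integrable f (leb a b))
    (hgag : gagliardo σ f ≤ ENNReal.ofReal (M ^ 2)) :
    |(⨍ y in I 0, f y ∂(leb a b)) - f x| ≤
      2 ^ (1 + σ) / (1 - 2⁻¹ ^ (σ - 1 / 2)) * M * h ^ (σ - 1 / 2) := by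
  have hr : (2⁻¹ : ℝ) ^ (σ - 1 / 2) < 1 :=
    Real.rpow_lt_one (by norm_num) (by norm_num) (by linarith)
  have hstep (n : ℕ) : dist (⨍ y in I n, f y ∂(leb a b)) (⨍ y in I (n + 1), f y ∂(leb a b)) ≤
      2 ^ (1 + σ) * M * h ^ (σ - 1 / 2) * (2⁻¹ ^ (σ - 1 / 2)) ^ n := by
    refine (hI.abs_setAverage_succ_sub_le (by linarith) hM hh hf.measurable hfi hgag n).trans_eq ?_
    rw [Real.mul_rpow hh.le (by positivity), ← Real.rpow_pow_comm (by norm_num)]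
    ring
  have hlim := tendsto_setAverage_of_continuousAt hfi hf.continuousAt hI.measurableSet
    (hI.leb_ne_zero hh) hI.tendsto_smallSets
  refine (dist_le_of_le_geometric_of_tendsto₀ _ _ hr hstep hlim).trans_eq ?_
  ring

end IsDyadicAt

theorem isDyadicAt_Ioo_right {x y : Dom a b} (hxy : x < y) :
    IsDyadicAt ((y : ℝ) - x) x
      fun n => Subtype.val ⁻¹' Ioo (x : ℝ) (x + ((y : ℝ) - x) * 2⁻¹ ^ n) := by
  have hh : 0 < (y : ℝ) - x := sub_pos.2 hxy
  have hle (n : ℕ) : ((y : ℝ) - x) * 2⁻¹ ^ n ≤ (y : ℝ) - x :=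
    mul_le_of_le_one_right hh.le (pow_le_one₀ (by norm_num) (by norm_num))
  refine ⟨fun n => measurable_subtype_coe measurableSet_Ioo, fun n => ?_, fun n z hz => ?_⟩
  · rw [leb_preimage_Ioo x.2.1.le (by linarith [hle n, y.2.2]), add_sub_cancel_left]
  · rw [abs_of_pos (sub_pos.2 hz.1)]
    linarith [hz.2]

theorem isDyadicAt_Ioo_left {x y : Dom a b} (hxy : x < y) :
    IsDyadicAt ((y : ℝ) - x) y
      fun n => Subtype.val ⁻¹' Ioo (y - ((y : ℝ) - x) * 2⁻¹ ^ n) (y : ℝ) := by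
  have hh : 0 < (y : ℝ) - x := sub_pos.2 hxy
  have hle (n : ℕ) : ((y : ℝ) - x) * 2⁻¹ ^ n ≤ (y : ℝ) - x :=
    mul_le_of_le_one_right hh.le (pow_le_one₀ (by norm_num) (by norm_num))
  refine ⟨fun n => measurable_subtype_coe measurableSet_Ioo, fun n => ?_, fun n z hz => ?_⟩
  · rw [leb_preimage_Ioo (by linarith [hle n, x.2.1]) y.2.2.le, sub_sub_cancel]
  · rw [abs_sub_comm, abs_of_pos (sub_pos.2 hz.2)]
    linarith [hz.1]

theorem abs_sub_le_of_gagliardo_le {σ M : ℝ} (hσ : 1 / 2 < σ) (hM : 0 ≤ M) {f : Dom a b → ℝ}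
    (hf : Continuous f) (hfi : Integrable f (leb a b))
    (hgag : gagliardo σ f ≤ ENNReal.ofReal (M ^ 2)) (x y : Dom a b) :
    |f x - f y| ≤
      2 * (2 ^ (1 + σ) / (1 - 2⁻¹ ^ (σ - 1 / 2)) * M * |(x : ℝ) - y| ^ (σ - 1 / 2)) := by
  wlog hxy : x < y generalizing x y
  · rcases (not_lt.1 hxy).eq_or_lt with rfl | h
    · rw [sub_self, sub_self, abs_zero, Real.zero_rpow (by linarith), mul_zero, mul_zero]
    · rw [abs_sub_comm, abs_sub_comm (x : ℝ)]
      exact this y x h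
  have hh : 0 < (y : ℝ) - x := sub_pos.2 hxy
  -- The two dyadic sequences start with the same interval, the one between `x` and `y`.
  have hx := (isDyadicAt_Ioo_right hxy).abs_setAverage_sub_le hσ hM hh hf hfi hgag
  have hy := (isDyadicAt_Ioo_left hxy).abs_setAverage_sub_le hσ hM hh hf hfi hgag
  simp only [pow_zero, mul_one, add_sub_cancel, sub_sub_cancel] at hx hy
  rw [abs_sub_comm (x : ℝ), abs_of_pos hh, two_mul]
  rw [abs_sub_comm] at hx
  exact (abs_sub_le _ _ _).trans (add_le_add hx hy)

end Campanato

section Embeddings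

variable {s t σ : ℝ} {α : ℕ}

theorem exists_gagliardo_le_energy (hab : a < b) (h0 : 0 ≤ σ) (h1 : σ < 1) (hσ : α + σ < t) :
    ∃ K < (⊤ : ℝ≥0∞), ∀ (f : Dom a b → ℝ) (G : ℕ → Dom a b → ℝ),
      IsJet ⌊t⌋₊ f G → energy t G < ⊤ → gagliardo σ (G α) ≤ K * energy t G := by
  have hαt : α ≤ ⌊t⌋₊ := Nat.le_floor (by linarith)
  rcases hαt.lt_or_eq with hlt | rfl
  · obtain ⟨K, hK, hK'⟩ := exists_gagliardo_le_of_isWeakDeriv hab h0 h1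
    refine ⟨K, hK, fun f G hG hE => ?_⟩
    have hle : ∫⁻ x, ‖G (α + 1) x‖ₑ ^ 2 ∂(leb a b) ≤ energy t G := lintegral_sq_le_energy hlt
    refine (hK' _ _ (hG.measurable (α + 1)) ((hG.isWeakDeriv α hαt).of_succ
      (hG.isWeakDeriv (α + 1) hlt)) (hle.trans_lt hE)).trans ?_
    gcongr
  · have hne : t ≠ ⌊t⌋₊ := fun ht => by linarith
    refine ⟨1 + 4 * leb a b univ, by finiteness, fun f G hG _ => ?_⟩
    refine (gagliardo_le_add (σ := t - ⌊t⌋₊) (by linarith) (by linarith) one_pos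
      (hG.measurable _)).trans ?_
    simp only [Real.one_rpow, inv_one, ENNReal.ofReal_one, one_pow, one_mul, add_mul]
    gcongr
    · exact gagliardo_le_energy hne
    · exact lintegral_sq_le_energy le_rfl

theorem tendsto_zero_of_le_add {ι ι' : Type*} {l : Filter ι} {l' : Filter ι'} [l'.NeBot]
    {f : ι → ℝ≥0∞} {A : ι' → ℝ≥0∞} (hA : Tendsto A l' (𝓝 0))
    (h : ∀ᶠ δ in l', ∃ B : ι → ℝ≥0∞, Tendsto B l (𝓝 0) ∧ ∀ i, f i ≤ A δ + B i) :
    Tendsto f l (𝓝 0) := by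
  rw [ENNReal.tendsto_nhds_zero]
  intro ε hε
  have hε2 : 0 < ε / 2 := ENNReal.half_pos hε.ne'
  obtain ⟨δ, ⟨B, hB, hf⟩, hδ⟩ := (h.and (ENNReal.tendsto_nhds_zero.1 hA _ hε2)).exists
  filter_upwards [ENNReal.tendsto_nhds_zero.1 hB _ hε2] with i hi
  exact (hf i).trans ((add_le_add hδ hi).trans_eq (ENNReal.add_halves ε))

theorem tendsto_ofReal_mul_rpow_nhdsGT_zero (c : ℝ) {r : ℝ} (hr : 0 < r) :
    Tendsto (fun δ : ℝ => ENNReal.ofReal (c * δ ^ r)) (𝓝[>] 0) (𝓝 0) := by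
  have h := ((Real.continuousAt_rpow_const 0 r (Or.inr hr.le)).tendsto.const_mul c).mono_left
    (nhdsWithin_le_nhds (s := Ioi 0))
  simpa [Real.zero_rpow hr.ne'] using ENNReal.tendsto_ofReal h

section Interpolation

variable {ι : Type*} {l : Filter ι} {u : ι → Dom a b → ℝ} {U : ι → ℕ → Dom a b → ℝ} {E : ℝ≥0∞}
  {κ : ι → ℝ}

theorem tendsto_lintegral_sq_zero (hab : a < b) (hα : α < t) (hU : ∀ i, IsJet ⌊t⌋₊ (u i) (U i))
    (hE : E < ⊤) (hUE : ∀ i, energy t (U i) ≤ E) (hκ : Tendsto κ l (𝓝 0))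
    (huκ : ∀ i x, |u i x| ≤ κ i) :
    Tendsto (fun i => ∫⁻ x, ‖U i α x‖ₑ ^ 2 ∂(leb a b)) l (𝓝 0) := by
  obtain ⟨σ, hσ0, hσ⟩ := exists_between (lt_min (sub_pos.2 hα) one_pos)
  obtain ⟨hσt, hσ1⟩ := lt_min_iff.1 hσ
  obtain ⟨K, hK, hK'⟩ := exists_gagliardo_le_energy hab hσ0.le hσ1 (t := t) (α := α) (by linarith)
  have hlim := ENNReal.Tendsto.mul_const (tendsto_ofReal_mul_rpow_nhdsGT_zero 16
    (mul_pos two_pos hσ0)) (.inr (ENNReal.mul_lt_top hK hE).ne)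
  rw [zero_mul] at hlim
  refine tendsto_zero_of_le_add hlim ?_
  filter_upwards [Ioc_mem_nhdsGT (sub_pos.2 hab)] with δ hδ
  obtain ⟨C, hC⟩ := exists_lintegral_sq_le_gagliardo_add (σ := σ) (by linarith) hδ.1 hδ.2 α
  refine ⟨fun i => ENNReal.ofReal (C * κ i ^ 2), ?_, fun i => ?_⟩
  · simpa using ENNReal.tendsto_ofReal ((hκ.pow 2).const_mul C)
  · refine (hC (u i) (U i α) (κ i) ((hU i).measurable α)
      ((hU i).isWeakDeriv α (Nat.le_floor hα.le)) (huκ i)).trans ?_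
    gcongr
    refine (hK' _ _ (hU i) ((hUE i).trans_lt hE)).trans ?_
    gcongr
    exact hUE i

theorem tendsto_gagliardo_zero (hab : a < b) (h0 : 0 ≤ σ) (h1 : σ < 1) (hσ : α + σ < t)
    (hU : ∀ i, IsJet ⌊t⌋₊ (u i) (U i)) (hE : E < ⊤) (hUE : ∀ i, energy t (U i) ≤ E)
    (hκ : Tendsto κ l (𝓝 0)) (huκ : ∀ i x, |u i x| ≤ κ i) :
    Tendsto (fun i => gagliardo σ (U i α)) l (𝓝 0) := by
  obtain ⟨τ, hτ0, hτ⟩ := exists_between (lt_min (lt_sub_iff_add_lt'.2 hσ) h1)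
  obtain ⟨hτt, hτ1⟩ := lt_min_iff.1 hτ
  obtain ⟨K, hK, hK'⟩ :=
    exists_gagliardo_le_energy hab (h0.trans hτ0.le) hτ1 (t := t) (α := α) (by linarith)
  have hlim := ENNReal.Tendsto.mul_const (ENNReal.Tendsto.pow (n := 2)
    (tendsto_ofReal_mul_rpow_nhdsGT_zero 1 (sub_pos.2 hτ0))) (.inr (ENNReal.mul_lt_top hK hE).ne)
  simp only [one_mul, ne_eq, OfNat.ofNat_ne_zero, not_false_eq_true, zero_pow, zero_mul] at hlim
  refine tendsto_zero_of_le_add hlim ?_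
  filter_upwards [self_mem_nhdsWithin] with δ hδ
  refine ⟨fun i => ENNReal.ofReal (δ ^ (1 / 2 + σ))⁻¹ ^ 2 * (4 * leb a b univ *
    ∫⁻ x, ‖U i α x‖ₑ ^ 2 ∂(leb a b)), ?_, fun i => ?_⟩
  · have hL2 := tendsto_lintegral_sq_zero hab (by linarith) hU hE hUE hκ huκ (α := α)
    simpa using ENNReal.Tendsto.const_mul (ENNReal.Tendsto.const_mul hL2
      (.inr (by finiteness : 4 * leb a b univ ≠ ⊤))) (.inr (by finiteness))
  · refine (gagliardo_le_add (by linarith) hτ0.le hδ ((hU i).measurable _)).trans ?_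
    gcongr
    refine (hK' _ _ (hU i) ((hUE i).trans_lt hE)).trans ?_
    gcongr
    exact hUE i

theorem tendsto_energy_zero (hab : a < b) (hs : 0 ≤ s) (hst : s < t)
    (hU : ∀ i, IsJet ⌊t⌋₊ (u i) (U i)) (hE : E < ⊤) (hUE : ∀ i, energy t (U i) ≤ E)
    (hκ : Tendsto κ l (𝓝 0)) (huκ : ∀ i x, |u i x| ≤ κ i) :
    Tendsto (fun i => energy s (U i)) l (𝓝 0) := by
  have hsum : Tendsto (fun i => ∑ α ∈ Finset.range (⌊s⌋₊ + 1), ∫⁻ x, ‖U i α x‖ₑ ^ 2 ∂(leb a b))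
      l (𝓝 0) := by
    rw [← Finset.sum_const_zero (s := Finset.range (⌊s⌋₊ + 1))]
    refine tendsto_finsetSum _ fun α hα => tendsto_lintegral_sq_zero hab ?_ hU hE hUE hκ huκ
    exact ((Nat.le_floor_iff hs).1 (Finset.mem_range_succ_iff.1 hα)).trans_lt hst
  simp only [energy]
  split_ifs with hint
  · simpa using hsum
  · simpa using hsum.add (tendsto_gagliardo_zero hab (sub_nonneg.2 (Nat.floor_le hs))
      (by linarith [Nat.lt_floor_add_one s]) (by linarith) hU hE hUE hκ huκ)

end Interpolation

theorem IsJet.zero_ae_eq {n : ℕ} {f : Dom a b → ℝ} {G : ℕ → Dom a b → ℝ} (h : IsJet n f G) :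
    G 0 =ᵐ[leb a b] f :=
  have h0 := h.isWeakDeriv 0 n.zero_le
  h0.ae_eq (isWeakDeriv_zero h0.1)

variable {D : ℝ≥0∞}

theorem integrable_of_mem_sobolevSpace {f : Dom a b → ℝ} (hf : f ∈ sobolevSpace a b t) :
    Integrable f (leb a b) :=
  have ⟨_, hC⟩ := hf.2.1
  integrable_of_continuous_bdd hf.1 hC

theorem exists_abs_sub_le_of_sobolevNorm_le (hab : a < b) (ht : 1 / 2 < t) (hD : D ≠ ⊤) :
    ∃ C γ : ℝ, 0 ≤ C ∧ 0 < γ ∧ ∀ f ∈ sobolevSpace a b t, sobolevNorm t f ≤ D →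
      ∀ x y, |f x - f y| ≤ C * |(x : ℝ) - y| ^ γ := by
  obtain ⟨σ, hσ, hσ'⟩ := exists_between (lt_min ht (by norm_num : (1 / 2 : ℝ) < 1))
  obtain ⟨hσt, hσ1⟩ := lt_min_iff.1 hσ'
  obtain ⟨K, hK, hK'⟩ := exists_gagliardo_le_energy hab (by linarith) hσ1 (t := t) (α := 0)
    (by simpa using hσt)
  have hr : 0 < 1 - (2⁻¹ : ℝ) ^ (σ - 1 / 2) :=
    sub_pos.2 (Real.rpow_lt_one (by norm_num) (by norm_num) (by linarith))
  refine ⟨2 * (2 ^ (1 + σ) / (1 - 2⁻¹ ^ (σ - 1 / 2)) * √(K * D ^ 2).toReal), σ - 1 / 2,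
    by positivity, by linarith, fun f hf hfD x y => ?_⟩
  obtain ⟨G, hG⟩ := exists_isJet hf.2.2
  have hE := hG.sobolevNorm_le_iff.1 hfD
  have hgag : gagliardo σ f ≤ ENNReal.ofReal (√(K * D ^ 2).toReal ^ 2) := by
    rw [Real.sq_sqrt ENNReal.toReal_nonneg, ENNReal.ofReal_toReal (by finiteness),
      ← gagliardo_congr hG.zero_ae_eq]
    refine (hK' _ _ hG (hE.trans_lt (by finiteness))).trans ?_
    gcongr
  refine (abs_sub_le_of_gagliardo_le hσ (Real.sqrt_nonneg _) hf.1
    (integrable_of_mem_sobolevSpace hf) hgag x y).trans_eq ?_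
  ring

theorem exists_abs_le_of_sobolevNorm_le (hab : a < b) (ht : 1 / 2 < t) (hD : D ≠ ⊤) :
    ∃ B, ∀ f ∈ sobolevSpace a b t, sobolevNorm t f ≤ D → ∀ x, |f x| ≤ B := by
  obtain ⟨C, γ, hC, hγ, h⟩ := exists_abs_sub_le_of_sobolevNorm_le hab ht hD
  have hleb : leb a b univ ≠ 0 := by simpa [leb_univ] using hab
  refine ⟨√(D ^ 2 / leb a b univ).toReal + C * (b - a) ^ γ, fun f hf hfD x => ?_⟩
  obtain ⟨G, hG⟩ := exists_isJet hf.2.2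
  have hL2 : ∫⁻ x, ‖f x‖ₑ ^ 2 ∂(leb a b) ≤ D ^ 2 := by
    have heq : ∫⁻ x, ‖G 0 x‖ₑ ^ 2 ∂(leb a b) = ∫⁻ x, ‖f x‖ₑ ^ 2 ∂(leb a b) :=
      lintegral_congr_ae (hG.zero_ae_eq.mono fun x hx => by simp only [hx])
    exact heq ▸ (lintegral_sq_le_energy (Nat.zero_le _)).trans (hG.sobolevNorm_le_iff.1 hfD)
  obtain ⟨y, hy⟩ := exists_le_laverage (μ := leb a b) (f := fun x => ‖f x‖ₑ ^ 2)
    (fun h => hleb (by simp [h])) (by have := hf.1.measurable; fun_prop)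
  have hfy : |f y| ≤ √(D ^ 2 / leb a b univ).toReal := by
    refine Real.abs_le_sqrt ?_
    rw [laverage_eq] at hy
    have := ENNReal.toReal_mono (by finiteness) (hy.trans (ENNReal.div_le_div_right hL2 _))
    simpa using this
  have hxy : |(x : ℝ) - y| ≤ b - a := by
    rw [abs_le]
    constructor <;> linarith [x.2.1, x.2.2, y.2.1, y.2.2]
  calc |f x| ≤ |f y| + |f x - f y| := by linarith [abs_sub_abs_le_abs_sub (f x) (f y)]
    _ ≤ _ := by
      gcongr
      refine (h f hf hfD x y).trans ?_
      gcongr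

theorem abs_le_toReal_supNorm {f : Dom a b → ℝ} (hf : ∃ C, ∀ x, |f x| ≤ C) (x : Dom a b) :
    |f x| ≤ (supNorm f).toReal := by
  obtain ⟨C, hC⟩ := hf
  have hfin : supNorm f < ⊤ := by
    refine (iSup_le fun x => ?_).trans_lt (ENNReal.ofReal_lt_top (r := C))
    rw [Real.enorm_eq_ofReal_abs]
    exact ENNReal.ofReal_le_ofReal (hC x)
  simpa using ENNReal.toReal_mono hfin.ne (le_iSup (fun x => ‖f x‖ₑ) x)

theorem tendsto_sobolevNorm_sub (hab : a < b) (hD : D ≠ ⊤) (hs : 0 ≤ s) (hst : s < t)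
    {ι : Type*} {l : Filter ι} {f g : ι → Dom a b → ℝ} (hf : ∀ i, f i ∈ sobolevSpace a b t)
    (hfD : ∀ i, sobolevNorm t (f i) ≤ D) (hg : ∀ i, g i ∈ sobolevSpace a b t)
    (hgD : ∀ i, sobolevNorm t (g i) ≤ D)
    (hfg : Tendsto (fun i => supNorm (f i - g i)) l (𝓝 0)) :
    Tendsto (fun i => sobolevNorm s (f i - g i)) l (𝓝 0) := by
  choose F hF using fun i => exists_isJet (hf i).2.2
  choose G hG using fun i => exists_isJet (hg i).2.2
  have hbdd (i : ι) : ∃ C, ∀ x, |(f i - g i) x| ≤ C := by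
    obtain ⟨B, hB⟩ := (hf i).2.1
    obtain ⟨C, hC⟩ := (hg i).2.1
    exact ⟨B + C, fun x => (abs_sub _ _).trans (add_le_add (hB x) (hC x))⟩
  have hE (i : ι) : energy t (F i - G i) ≤ 2 * (D ^ 2 + D ^ 2) := by
    refine (energy_sub_le (hF i).measurable (hG i).measurable).trans ?_
    gcongr
    · exact (hF i).sobolevNorm_le_iff.1 (hfD i)
    · exact (hG i).sobolevNorm_le_iff.1 (hgD i)
  have hlim := tendsto_energy_zero hab hs hst (fun i => (hF i).sub (hG i)) (by finiteness) hE
    ((ENNReal.tendsto_toReal ENNReal.zero_ne_top).comp hfg) fun i => abs_le_toReal_supNorm (hbdd i)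
  simp only [fun i => (((hF i).sub (hG i)).mono (Nat.floor_mono hst.le)).sobolevNorm_eq]
  simpa using hlim.ennrpow_const (1 / 2 : ℝ)

end Embeddings

section Closedness

variable {t ζ D : ℝ}

theorem const_mem_densities (hab : a < b) (hζ : ζ ≤ (b - a)⁻¹) (hD : 0 ≤ D)
    (hDb : (b - a)⁻¹ ≤ D ^ 2) : (fun _ => (b - a)⁻¹) ∈ densities a b t ζ D := by
  have hba : 0 < b - a := sub_pos.2 hab
  have hjet : IsJet ⌊t⌋₊ (fun _ : Dom a b => (b - a)⁻¹)
      (fun α _ => if α = 0 then (b - a)⁻¹ else 0) :=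
    ⟨fun _ => measurable_const, fun α _ => isWeakDeriv_const _ _⟩
  have hL2 (α : ℕ) : ∫⁻ _ : Dom a b, ‖if α = 0 then (b - a)⁻¹ else 0‖ₑ ^ 2 ∂(leb a b) =
      if α = 0 then ENNReal.ofReal (b - a)⁻¹ else 0 := by
    rw [lintegral_const, leb_univ]
    split_ifs
    · rw [Real.enorm_of_nonneg (by positivity), ← ENNReal.ofReal_pow (by positivity),
        ← ENNReal.ofReal_mul (by positivity)]
      field_simp
    · simp
  have hnorm : sobolevNorm t (fun _ : Dom a b => (b - a)⁻¹) ≤ ENNReal.ofReal D := by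
    rw [hjet.sobolevNorm_le_iff, ← ENNReal.ofReal_pow hD, energy]
    simp_rw [hL2]
    simpa [gagliardo] using ENNReal.ofReal_le_ofReal hDb
  refine ⟨⟨continuous_const, ⟨_, fun _ => le_rfl⟩, hnorm.trans_lt ENNReal.ofReal_lt_top⟩, ?_,
    fun _ => hζ, hnorm⟩
  rw [integral_const, measureReal_def, leb_univ, ENNReal.toReal_ofReal hba.le, smul_eq_mul,
    mul_inv_cancel₀ hba.ne']

theorem integrable_of_mem_densities {p : Dom a b → ℝ} (hp : p ∈ densities a b t ζ D) :
    Integrable p (leb a b) :=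
  integrable_of_mem_sobolevSpace hp.1

theorem midpoint_mem_densities {p q : Dom a b → ℝ} (hp : p ∈ densities a b t ζ D)
    (hq : q ∈ densities a b t ζ D) : (2⁻¹ : ℝ) • (p + q) ∈ densities a b t ζ D := by
  obtain ⟨F, hF⟩ := exists_isJet hp.1.2.2
  obtain ⟨G, hG⟩ := exists_isJet hq.1.2.2
  have hnorm : sobolevNorm t ((2⁻¹ : ℝ) • (p + q)) ≤ ENNReal.ofReal D := by
    have hFD := hF.sobolevNorm_le_iff.1 hp.2.2.2
    have hGD := hG.sobolevNorm_le_iff.1 hq.2.2.2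
    rw [((hF.add hG).const_smul 2⁻¹).sobolevNorm_le_iff, energy_const_smul (hF.add hG).measurable]
    calc ‖(2⁻¹ : ℝ)‖ₑ ^ 2 * energy t (F + G)
      _ ≤ ‖(2⁻¹ : ℝ)‖ₑ ^ 2 * (2 * (ENNReal.ofReal D ^ 2 + ENNReal.ofReal D ^ 2)) := by
        gcongr
        exact (energy_add_le hF.measurable hG.measurable).trans (by gcongr)
      _ = ‖(2⁻¹ : ℝ) * 2‖ₑ ^ 2 * ENNReal.ofReal D ^ 2 := by
        rw [enorm_mul, (by simp [Real.enorm_eq_ofReal_abs] : ‖(2 : ℝ)‖ₑ = 2)]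
        ring
      _ = ENNReal.ofReal D ^ 2 := by norm_num
  obtain ⟨B, hB⟩ := hp.1.2.1
  obtain ⟨B', hB'⟩ := hq.1.2.1
  refine ⟨⟨(hp.1.1.add hq.1.1).const_smul _, ⟨2⁻¹ * (B + B'), fun x => ?_⟩,
    hnorm.trans_lt ENNReal.ofReal_lt_top⟩, ?_, fun x => ?_, hnorm⟩
  · simp only [Pi.smul_apply, Pi.add_apply, smul_eq_mul, abs_mul]
    gcongr
    · norm_num
    · exact (abs_add_le _ _).trans (add_le_add (hB x) (hB' x))
  · simp only [Pi.smul_apply, Pi.add_apply, smul_eq_mul]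
    rw [integral_const_mul, integral_add (integrable_of_mem_densities hp)
      (integrable_of_mem_densities hq), hp.2.1, hq.2.1]
    norm_num
  · simp only [Pi.smul_apply, Pi.add_apply, smul_eq_mul]
    linarith [hp.2.2.1 x, hq.2.2.1 x]

theorem tendsto_eLpNorm_one_of_forall_abs_sub_le {f : ℕ → Dom a b → ℝ} {p : Dom a b → ℝ}
    {κ : ℕ → ℝ} (hκ : Tendsto κ atTop (𝓝 0)) (h : ∀ n x, |f n x - p x| ≤ κ n) :
    Tendsto (fun n => eLpNorm (f n - p) 1 (leb a b)) atTop (𝓝 0) := by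
  have hlim := ENNReal.Tendsto.const_mul (ENNReal.tendsto_ofReal hκ)
    (.inr (by finiteness : leb a b univ ^ (1 : ℝ≥0∞).toReal⁻¹ ≠ ⊤))
  exact tendsto_of_tendsto_of_tendsto_of_le_of_le tendsto_const_nhds (by simpa using hlim)
    (fun _ => zero_le) fun n => eLpNorm_le_of_ae_bound (ae_of_all _ (h n))

theorem IsTest.tendsto_integral_mul {φ : ℝ → ℝ} (hφ : IsTest a b φ) {f : ℕ → Dom a b → ℝ}
    {p : Dom a b → ℝ} (hf : ∀ n, LocallyIntegrable (f n) (leb a b))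
    (hp : LocallyIntegrable p (leb a b))
    (h : Tendsto (fun n => eLpNorm (f n - p) 1 (leb a b)) atTop (𝓝 0)) :
    Tendsto (fun n => ∫ x, f n x * φ x ∂(leb a b)) atTop (𝓝 (∫ x, p x * φ x ∂(leb a b))) := by
  obtain ⟨C, hC⟩ := hφ.exists_bound
  refine tendsto_integral_of_L1 _ (hφ.integrable_mul hp).aestronglyMeasurable
    (.of_forall fun n => hφ.integrable_mul (hf n)) ?_
  refine tendsto_of_tendsto_of_tendsto_of_le_of_le tendsto_const_nhds
    (by simpa using ENNReal.Tendsto.mul_const h (.inr (ENNReal.ofReal_ne_top (r := C))))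
    (fun _ => zero_le) fun n => ?_
  simp only [eLpNorm_one_eq_lintegral_enorm]
  rw [← lintegral_mul_const' _ _ ENNReal.ofReal_ne_top]
  refine lintegral_mono fun x => ?_
  rw [← sub_mul, enorm_mul, Real.enorm_eq_ofReal_abs (φ x)]
  gcongr
  · rfl
  · exact hC x

theorem IsWeakDeriv.of_tendsto_eLpNorm_one {α : ℕ} {f F : ℕ → Dom a b → ℝ} {p g : Dom a b → ℝ}
    (hF : ∀ n, IsWeakDeriv α (f n) (F n)) (hp : LocallyIntegrable p (leb a b))
    (hg : LocallyIntegrable g (leb a b))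
    (hfp : Tendsto (fun n => eLpNorm (f n - p) 1 (leb a b)) atTop (𝓝 0))
    (hFg : Tendsto (fun n => eLpNorm (F n - g) 1 (leb a b)) atTop (𝓝 0)) :
    IsWeakDeriv α p g := by
  refine isWeakDeriv_iff.2 ⟨hp, hg, fun φ hφ => ?_⟩
  have hl := (hφ.iteratedDeriv α).tendsto_integral_mul (fun n => (hF n).1) hp hfp
  have hr := (hφ.tendsto_integral_mul (fun n => (hF n).2.1) hg hFg).const_mul ((-1 : ℝ) ^ α)
  exact tendsto_nhds_unique hl (hr.congr fun n => ((hF n).integral_eq hφ).symm)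

theorem lintegral_enorm_sq_le_liminf {X : Type*} [MeasurableSpace X] {μ : Measure X}
    {f : ℕ → X → ℝ} {g : X → ℝ} (hf : ∀ n, Measurable (f n))
    (h : ∀ᵐ x ∂μ, Tendsto (fun n => f n x) atTop (𝓝 (g x))) :
    ∫⁻ x, ‖g x‖ₑ ^ 2 ∂μ ≤ liminf (fun n => ∫⁻ x, ‖f n x‖ₑ ^ 2 ∂μ) atTop :=
  (lintegral_congr_ae (h.mono fun _ hx =>
    ((ENNReal.continuous_pow 2).tendsto _ |>.comp hx.enorm).liminf_eq.symm)).trans_le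
    (lintegral_liminf_le fun n => (hf n).enorm.pow_const 2)

theorem gagliardo_le_liminf {σ : ℝ} {f : ℕ → Dom a b → ℝ} {g : Dom a b → ℝ}
    (hf : ∀ n, Measurable (f n)) (hg : Measurable g)
    (h : ∀ᵐ x ∂(leb a b), Tendsto (fun n => f n x) atTop (𝓝 (g x))) :
    gagliardo σ g ≤ liminf (fun n => gagliardo σ (f n)) atTop := by
  simp only [gagliardo_eq_lintegral_fracQuot (hf _), gagliardo_eq_lintegral_fracQuot hg]
  refine lintegral_enorm_sq_le_liminf (fun n => measurable_fracQuot (hf n)) ?_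
  filter_upwards [Measure.quasiMeasurePreserving_fst.ae h, Measure.quasiMeasurePreserving_snd.ae h]
    with p hp1 hp2
  exact (hp1.sub hp2).div_const _

theorem liminf_add_liminf_le (u v : ℕ → ℝ≥0∞) :
    liminf u atTop + liminf v atTop ≤ liminf (fun n => u n + v n) atTop := by
  simp only [liminf_eq_iSup_iInf_of_nat]
  rw [ENNReal.iSup_add_iSup_of_monotone]
  · exact iSup_mono fun n => le_iInf₂ fun m hm => add_le_add (iInf₂_le m hm) (iInf₂_le m hm)
  all_goals exact fun k l hkl => biInf_mono fun m hm => hkl.trans hm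

theorem sum_liminf_le_liminf_sum {ι : Type*} (u : ι → ℕ → ℝ≥0∞) (A : Finset ι) :
    ∑ i ∈ A, liminf (u i) atTop ≤ liminf (fun n => ∑ i ∈ A, u i n) atTop := by
  classical
  induction A using Finset.induction with
  | empty => simp
  | insert i A hi ih =>
    simp only [Finset.sum_insert hi]
    exact (add_le_add_right ih _).trans (liminf_add_liminf_le _ _)

theorem energy_le_liminf {F : ℕ → ℕ → Dom a b → ℝ} {G : ℕ → Dom a b → ℝ}
    (hF : ∀ n α, Measurable (F n α)) (hG : ∀ α, Measurable (G α))
    (h : ∀ α ≤ ⌊t⌋₊, ∀ᵐ x ∂(leb a b), Tendsto (fun n => F n α x) atTop (𝓝 (G α x))) :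
    energy t G ≤ liminf (fun n => energy t (F n)) atTop := by
  have hL2 : ∑ α ∈ Finset.range (⌊t⌋₊ + 1), ∫⁻ x, ‖G α x‖ₑ ^ 2 ∂(leb a b) ≤
      liminf (fun n => ∑ α ∈ Finset.range (⌊t⌋₊ + 1), ∫⁻ x, ‖F n α x‖ₑ ^ 2 ∂(leb a b)) atTop :=
    (Finset.sum_le_sum fun α hα => lintegral_enorm_sq_le_liminf (fun n => hF n α)
      (h α (Finset.mem_range_succ_iff.1 hα))).trans (sum_liminf_le_liminf_sum _ _)
  unfold energy
  split_ifs
  · simpa using hL2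
  · exact (add_le_add hL2 (gagliardo_le_liminf (fun n => hF n _) (hG _) (h _ le_rfl))).trans
      (liminf_add_liminf_le _ _)

theorem eLpNorm_two_sq {X E : Type*} [MeasurableSpace X] {μ : Measure X} [NormedAddCommGroup E]
    (f : X → E) : eLpNorm f 2 μ ^ 2 = ∫⁻ x, ‖f x‖ₑ ^ 2 ∂μ := by
  simpa using eLpNorm_nnreal_pow_eq_lintegral (f := f) (μ := μ) two_ne_zero

theorem exists_strictMono_forall_lt_of_tendsto {e : ℕ × ℕ → ℝ≥0∞} (he : Tendsto e atTop (𝓝 0))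
    {η : ℕ → ℝ≥0∞} (hη : ∀ N, 0 < η N) :
    ∃ ψ : ℕ → ℕ, StrictMono ψ ∧ ∀ N n m, N ≤ n → N ≤ m → e (ψ n, ψ m) < η N := by
  have hfast (N : ℕ) : ∀ᶠ k in atTop, ∀ n ≥ k, ∀ m ≥ k, e (n, m) < η N := by
    obtain ⟨k, hk⟩ := eventually_atTop.1 (he.eventually_lt_const (hη N))
    filter_upwards [eventually_ge_atTop (max k.1 k.2)] with l hl n hn m hm
    exact hk (n, m) ⟨((le_max_left _ _).trans hl).trans hn, ((le_max_right _ _).trans hl).trans hm⟩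
  obtain ⟨ψ, hψ, hψ'⟩ := extraction_forall_of_eventually hfast
  exact ⟨ψ, hψ, fun N n m hn hm => hψ' N _ (hψ.monotone hn) _ (hψ.monotone hm)⟩

theorem exists_measurable_tendsto_of_eLpNorm_sub_lt {X : Type*} [MeasurableSpace X]
    {μ : Measure X} {p : ℝ≥0∞} (hp : 1 ≤ p) {u : ℕ → X → ℝ} (hu : ∀ n, Measurable (u n))
    (h : ∀ N n m, N ≤ n → N ≤ m → eLpNorm (u n - u m) p μ < 2⁻¹ ^ N) :
    ∃ g, Measurable g ∧ (∀ᵐ x ∂μ, Tendsto (fun n => u n x) atTop (𝓝 (g x))) ∧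
      Tendsto (fun n => eLpNorm (u n - g) p μ) atTop (𝓝 0) := by
  have hsum : ∑' N : ℕ, (2⁻¹ : ℝ≥0∞) ^ N ≠ ⊤ := by simp [ENNReal.tsum_geometric]
  have hu' (n : ℕ) : AEStronglyMeasurable (u n) μ := (hu n).aestronglyMeasurable
  obtain ⟨g, hg, hug⟩ := measurable_limit_of_tendsto_metrizable_ae
    (fun n => (hu n).aemeasurable) (Lp.ae_tendsto_of_cauchy_eLpNorm hu' hp hsum h)
  exact ⟨g, hg, hug, Lp.cauchy_tendsto_of_tendsto hu' g hsum h hug⟩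

theorem tendsto_eLpNorm_one_of_two {X : Type*} [MeasurableSpace X] {μ : Measure X}
    [IsFiniteMeasure μ] {u : ℕ → X → ℝ} (hu : ∀ n, AEStronglyMeasurable (u n) μ)
    (h : Tendsto (fun n => eLpNorm (u n) 2 μ) atTop (𝓝 0)) :
    Tendsto (fun n => eLpNorm (u n) 1 μ) atTop (𝓝 0) := by
  refine tendsto_of_tendsto_of_tendsto_of_le_of_le tendsto_const_nhds ?_ (fun _ => zero_le)
    fun n => eLpNorm_le_eLpNorm_mul_rpow_measure_univ one_le_two (hu n)
  have hC : μ univ ^ (1 / (1 : ℝ≥0∞).toReal - 1 / (2 : ℝ≥0∞).toReal) ≠ ⊤ :=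
    ENNReal.rpow_ne_top_of_nonneg (by norm_num) (by finiteness)
  simpa only [zero_mul] using ENNReal.Tendsto.mul_const h (.inr hC)

theorem exists_isJet_of_tendsto_energy_sub {f : ℕ → Dom a b → ℝ} {F : ℕ → ℕ → Dom a b → ℝ}
    {p : Dom a b → ℝ} (hF : ∀ n, IsJet ⌊t⌋₊ (f n) (F n)) (hp : LocallyIntegrable p (leb a b))
    (hfp : Tendsto (fun n => eLpNorm (f n - p) 1 (leb a b)) atTop (𝓝 0)) {E : ℝ≥0∞} (hE : E < ⊤)
    (hFE : ∀ n, energy t (F n) ≤ E)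
    (hcauchy : Tendsto (fun n : ℕ × ℕ => energy t (F n.1 - F n.2)) atTop (𝓝 0)) :
    ∃ G, IsJet ⌊t⌋₊ p G ∧ energy t G ≤ E := by
  obtain ⟨ψ, hψ, hfast⟩ := exists_strictMono_forall_lt_of_tendsto hcauchy
    (η := fun N => (2⁻¹ ^ N) ^ 2) fun N => by simp [pos_iff_ne_zero]
  have hLp (α : ℕ) (hα : α ≤ ⌊t⌋₊) (N n m : ℕ) (hn : N ≤ n) (hm : N ≤ m) :
      eLpNorm (F (ψ n) α - F (ψ m) α) 2 (leb a b) < 2⁻¹ ^ N := by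
    refine lt_of_pow_lt_pow_left' 2 ?_
    rw [eLpNorm_two_sq]
    exact (lintegral_sq_le_energy hα).trans_lt (hfast N n m hn hm)
  have hlim (α : ℕ) : ∃ g : Dom a b → ℝ, Measurable g ∧ (α ≤ ⌊t⌋₊ →
      (∀ᵐ x ∂(leb a b), Tendsto (fun n => F (ψ n) α x) atTop (𝓝 (g x))) ∧
        Tendsto (fun n => eLpNorm (F (ψ n) α - g) 2 (leb a b)) atTop (𝓝 0)) := by
    by_cases hα : α ≤ ⌊t⌋₊
    · obtain ⟨g, hg, hg'⟩ := exists_measurable_tendsto_of_eLpNorm_sub_lt one_le_two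
        (fun n => (hF (ψ n)).measurable α) (hLp α hα)
      exact ⟨g, hg, fun _ => hg'⟩
    · exact ⟨0, measurable_zero, fun h => absurd h hα⟩
  choose G hGm hG using hlim
  have hGE : energy t G ≤ E :=
    (energy_le_liminf (fun n => (hF (ψ n)).measurable) hGm fun α hα => (hG α hα).1).trans
      (liminf_le_of_frequently_le' (.of_forall fun n => hFE _))
  refine ⟨G, ⟨hGm, fun α hα => ?_⟩, hGE⟩
  have hGi : Integrable (G α) (leb a b) :=
    integrable_of_lintegral_sq_lt_top (hGm α).aestronglyMeasurable
      ((lintegral_sq_le_energy hα).trans_lt (hGE.trans_lt hE))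
  exact .of_tendsto_eLpNorm_one (fun n => (hF (ψ n)).isWeakDeriv α hα) hp
    hGi.locallyIntegrable (hfp.comp hψ.tendsto_atTop)
    (tendsto_eLpNorm_one_of_two (fun n => (((hF _).measurable α).sub (hGm α)).aestronglyMeasurable)
      (hG α hα).2)

theorem le_mul_sub_mul_biInf_of_parallelogram {V : Type*} [AddCommGroup V] [Module ℝ V]
    {q : V → ℝ≥0∞} {S : Set V} {x y : V} {M : ℝ≥0∞} (hmid : (2⁻¹ : ℝ) • (x + y) ∈ S)
    (hpar : 4 * q ((2⁻¹ : ℝ) • (x + y)) + q (x - y) = 2 * (q x + q y)) (hx : q x ≤ M)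
    (hy : q y ≤ M) (hS : ⨅ z ∈ S, q z ≠ ⊤) :
    q (x - y) ≤ 4 * M - 4 * ⨅ z ∈ S, q z := by
  refine ENNReal.le_sub_of_add_le_left (by finiteness) ?_
  calc 4 * (⨅ z ∈ S, q z) + q (x - y)
    _ ≤ 4 * q ((2⁻¹ : ℝ) • (x + y)) + q (x - y) := by
      gcongr
      exact biInf_le _ hmid
    _ = 2 * (q x + q y) := hpar
    _ ≤ 2 * (M + M) := by gcongr
    _ = 4 * M := by ring

theorem exists_seq_tendsto_sub_of_parallelogram {V : Type*} [AddCommGroup V] [Module ℝ V]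
    {q : V → ℝ≥0∞} {S : ℕ → Set V} (hS : Antitone S) (hne : ∀ k, (S k).Nonempty)
    (hmid : ∀ k, ∀ x ∈ S k, ∀ y ∈ S k, (2⁻¹ : ℝ) • (x + y) ∈ S k)
    (hpar : ∀ x ∈ S 0, ∀ y ∈ S 0,
      4 * q ((2⁻¹ : ℝ) • (x + y)) + q (x - y) = 2 * (q x + q y))
    {E : ℝ≥0∞} (hE : E < ⊤) (hq : ∀ x ∈ S 0, q x ≤ E) :
    ∃ x : ℕ → V, (∀ n, x n ∈ S n) ∧ Tendsto (fun n : ℕ × ℕ => q (x n.1 - x n.2)) atTop (𝓝 0) := by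
  have hS0 (k : ℕ) : S k ⊆ S 0 := hS k.zero_le
  let d (k : ℕ) : ℝ≥0∞ := ⨅ x ∈ S k, q x
  let ε (k : ℕ) : ℝ≥0∞ := (k + 1 : ℝ≥0∞)⁻¹
  have hdE (k : ℕ) : d k ≤ E := (biInf_le _ (hne k).some_mem).trans (hq _ (hS0 k (hne k).some_mem))
  have hd : Monotone d := fun k l hkl => biInf_mono (hS hkl)
  have hsup : ⨆ k, d k < ⊤ := (iSup_le hdE).trans_lt hE
  have hex (k : ℕ) : ∃ x ∈ S k, q x < d k + ε k := by
    have hlt : d k < d k + ε k :=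
      ENNReal.lt_add_right ((hdE k).trans_lt hE).ne (ENNReal.inv_ne_zero.2 (by finiteness))
    simpa only [d, iInf_lt_iff, exists_prop] using hlt
  -- Nearly minimizing sequences are Cauchy, as for projections in Hilbert space.
  choose x hxS hx using hex
  have hε : Tendsto ε atTop (𝓝 0) := by
    simpa only [Function.comp_def, Nat.cast_succ] using
      ENNReal.tendsto_inv_nat_nhds_zero.comp (tendsto_add_atTop_nat 1)
  have hεanti : Antitone ε := fun k l hkl => by simp only [ε]; gcongr
  have hbound (n : ℕ × ℕ) : q (x n.1 - x n.2) ≤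
      4 * ((⨆ k, d k) + ε (min n.1 n.2)) - 4 * d (min n.1 n.2) := by
    set k := min n.1 n.2
    have h1 : x n.1 ∈ S k := hS (min_le_left _ _) (hxS _)
    have h2 : x n.2 ∈ S k := hS (min_le_right _ _) (hxS _)
    have hqx {m : ℕ} (hm : k ≤ m) : q (x m) ≤ (⨆ k, d k) + ε k :=
      (hx m).le.trans (add_le_add (le_iSup d m) (hεanti hm))
    exact le_mul_sub_mul_biInf_of_parallelogram (hmid k _ h1 _ h2) (hpar _ (hS0 k h1) _ (hS0 k h2))
      (hqx (min_le_left _ _)) (hqx (min_le_right _ _)) ((hdE k).trans_lt hE).ne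
  refine ⟨x, hxS, tendsto_of_tendsto_of_tendsto_of_le_of_le tendsto_const_nhds ?_
    (fun _ => zero_le) hbound⟩
  have hmin : Tendsto (fun n : ℕ × ℕ => min n.1 n.2) atTop atTop :=
    tendsto_atTop.2 fun N => (eventually_ge_atTop (N, N)).mono fun n hn => le_min hn.1 hn.2
  have hlim : Tendsto (fun k => 4 * ((⨆ k, d k) + ε k) - 4 * d k) atTop (𝓝 0) := by
    have := ENNReal.Tendsto.sub
      (ENNReal.Tendsto.const_mul (tendsto_const_nhds.add hε) (.inr (by finiteness)))
      (ENNReal.Tendsto.const_mul (tendsto_atTop_iSup hd) (.inr (by finiteness)))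
      (a := 4 * ((⨆ k, d k) + 0)) (b := 4 * ⨆ k, d k) (.inl (by finiteness))
    simpa using this
  exact hlim.comp hmin

theorem tendstoUniformly_of_forall_abs_sub_le {X : Type*} {f : ℕ → X → ℝ} {p : X → ℝ} {κ : ℕ → ℝ}
    (hκ : Tendsto κ atTop (𝓝 0)) (h : ∀ n x, |f n x - p x| ≤ κ n) :
    TendstoUniformly f p atTop := by
  rw [Metric.tendstoUniformly_iff]
  intro ε hε
  filter_upwards [hκ.eventually_lt_const hε] with n hn x
  rw [dist_comm]
  exact (h n x).trans_lt hn

theorem exists_seq_tendsto_energy_sub {p : Dom a b → ℝ}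
    (hp : ∀ ε > 0, ∃ q ∈ densities a b t ζ D, ∀ x, |q x - p x| ≤ ε) :
    ∃ (f : ℕ → Dom a b → ℝ) (F : ℕ → ℕ → Dom a b → ℝ), (∀ n, f n ∈ densities a b t ζ D) ∧
      (∀ n x, |f n x - p x| ≤ 1 / (n + 1)) ∧ (∀ n, IsJet ⌊t⌋₊ (f n) (F n)) ∧
      Tendsto (fun n : ℕ × ℕ => energy t (F n.1 - F n.2)) atTop (𝓝 0) := by
  let S (k : ℕ) : Set (ℕ → Dom a b → ℝ) := {F | ∃ f ∈ densities a b t ζ D,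
    (∀ x, |f x - p x| ≤ 1 / (k + 1)) ∧ IsJet ⌊t⌋₊ f F}
  have hanti : Antitone S := fun k l hkl F ⟨f, hf, hfp, hF⟩ =>
    ⟨f, hf, fun x => (hfp x).trans (by gcongr), hF⟩
  have hne (k : ℕ) : (S k).Nonempty := by
    obtain ⟨f, hf, hfp⟩ := hp (1 / (k + 1)) (by positivity)
    obtain ⟨F, hF⟩ := exists_isJet hf.1.2.2
    exact ⟨F, f, hf, hfp, hF⟩
  have hmid (k : ℕ) : ∀ F ∈ S k, ∀ G ∈ S k, (2⁻¹ : ℝ) • (F + G) ∈ S k := by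
    rintro F ⟨f, hf, hfp, hF⟩ G ⟨g, hg, hgp, hG⟩
    refine ⟨_, midpoint_mem_densities hf hg, fun x => ?_, (hF.add hG).const_smul 2⁻¹⟩
    have hfx := abs_le.1 (hfp x)
    have hgx := abs_le.1 (hgp x)
    simp only [Pi.smul_apply, Pi.add_apply, smul_eq_mul]
    exact abs_le.2 ⟨by linarith, by linarith⟩
  have hpar : ∀ F ∈ S 0, ∀ G ∈ S 0,
      4 * energy t ((2⁻¹ : ℝ) • (F + G)) + energy t (F - G) = 2 * (energy t F + energy t G) := by
    rintro F ⟨f, -, -, hF⟩ G ⟨g, -, -, hG⟩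
    have hfour : (4 : ℝ≥0∞) * ‖(2⁻¹ : ℝ)‖ₑ ^ 2 = 1 := by
      rw [Real.enorm_of_nonneg (by norm_num), ← ENNReal.ofReal_pow (by norm_num),
        ← ENNReal.ofReal_ofNat, ← ENNReal.ofReal_mul (by norm_num)]
      norm_num
    rw [energy_const_smul (hF.add hG).measurable, ← mul_assoc, hfour, one_mul,
      energy_parallelogram hF.measurable hG.measurable]
  have hE : ∀ F ∈ S 0, energy t F ≤ ENNReal.ofReal D ^ 2 := fun F ⟨f, hf, _, hF⟩ =>
    hF.sobolevNorm_le_iff.1 hf.2.2.2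
  obtain ⟨F, hFS, hcauchy⟩ :=
    exists_seq_tendsto_sub_of_parallelogram hanti hne hmid hpar (by finiteness) hE
  choose f hf hfp hF using hFS
  exact ⟨f, F, hf, hfp, hF, hcauchy⟩

theorem mem_densities_of_forall_approx {p : Dom a b → ℝ}
    (hp : ∀ ε > 0, ∃ q ∈ densities a b t ζ D, ∀ x, |q x - p x| ≤ ε) :
    p ∈ densities a b t ζ D := by
  obtain ⟨f, F, hf, hfp, hF, hcauchy⟩ := exists_seq_tendsto_energy_sub hp
  have hκ : Tendsto (fun n : ℕ => 1 / ((n : ℝ) + 1)) atTop (𝓝 0) :=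
    tendsto_one_div_add_atTop_nhds_zero_nat
  have hunif := tendstoUniformly_of_forall_abs_sub_le hκ hfp
  have hpc : Continuous p := hunif.continuous (.of_forall fun n => (hf n).1.1)
  have hpB : ∃ B, ∀ x, |p x| ≤ B := by
    obtain ⟨B, hB⟩ := (hf 0).1.2.1
    refine ⟨B + 1 / ((0 : ℕ) + 1), fun x => ?_⟩
    linarith [hB x, hfp 0 x, abs_sub_comm (f 0 x) (p x), abs_sub_abs_le_abs_sub (p x) (f 0 x)]
  have hpi : Integrable p (leb a b) := integrable_of_continuous_bdd hpc hpB.choose_spec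
  have hL1 : Tendsto (fun n => eLpNorm (f n - p) 1 (leb a b)) atTop (𝓝 0) :=
    tendsto_eLpNorm_one_of_forall_abs_sub_le hκ hfp
  obtain ⟨G, hG, hGE⟩ := exists_isJet_of_tendsto_energy_sub hF hpi.locallyIntegrable hL1
    (by finiteness) (fun n => (hF n).sobolevNorm_le_iff.1 (hf n).2.2.2) hcauchy
  have hnorm : sobolevNorm t p ≤ ENNReal.ofReal D := hG.sobolevNorm_le_iff.2 hGE
  have hint : Tendsto (fun _ : ℕ => (1 : ℝ)) atTop (𝓝 (∫ x, p x ∂(leb a b))) := by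
    simpa only [(hf _).2.1] using tendsto_integral_of_L1' p hpi.aestronglyMeasurable
      (.of_forall fun n => integrable_of_mem_densities (hf n)) hL1
  exact ⟨⟨hpc, hpB, hnorm.trans_lt ENNReal.ofReal_lt_top⟩,
    tendsto_nhds_unique hint tendsto_const_nhds,
    fun x => ge_of_tendsto' (hunif.tendsto_at x) fun n => (hf n).2.2.1 x, hnorm⟩

end Closedness

section Compactness

open BoundedContinuousFunction

variable {t ζ D : ℝ}

/-- The inclusion of the open interval into the closed interval. -/
def toIcc (x : Dom a b) : Icc a b := ⟨x, Ioo_subset_Icc_self x.2⟩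

theorem isometry_toIcc : Isometry (toIcc : Dom a b → Icc a b) := fun _ _ => rfl

theorem continuous_comp_toIcc (F : Icc a b →ᵇ ℝ) :
    Continuous fun x : Dom a b => F (toIcc x) :=
  F.continuous.comp isometry_toIcc.continuous

theorem denseRange_toIcc (hab : a < b) : DenseRange (toIcc : Dom a b → Icc a b) := by
  intro y
  have hrange : Subtype.val '' range (toIcc : Dom a b → Icc a b) = Ioo a b := by
    rw [← range_comp]
    exact Subtype.range_coe
  rw [closure_subtype, hrange, closure_Ioo hab.ne]
  exact y.2

/-- The bounded continuous functions on `[a, b]` whose restrictions to `(a, b)` are the elements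
of `𝒫(t, ζ, D)`. Every element of `𝒫(t, ζ, D)` has a unique such extension, so this set is a copy
of `𝒫(t, ζ, D)`, with the sup-norm metric, inside a space of functions on a compact interval. -/
def extDensities (a b t ζ D : ℝ) : Set (Icc a b →ᵇ ℝ) :=
  {F | F ∘ toIcc ∈ densities a b t ζ D}

theorem tendsto_const_mul_rpow_zero {γ : ℝ} (hγ : 0 < γ) (C : ℝ) :
    Tendsto (fun r : ℝ => C * r ^ γ) (𝓝 0) (𝓝 0) := by
  simpa [Real.zero_rpow hγ.ne'] using
    (Real.continuousAt_rpow_const 0 γ (Or.inr hγ.le)).tendsto.const_mul C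

theorem uniformContinuous_of_mem_densities (hab : a < b) (ht : 1 / 2 < t) {p : Dom a b → ℝ}
    (hp : p ∈ densities a b t ζ D) : UniformContinuous p := by
  obtain ⟨C, γ, -, hγ, hC⟩ := exists_abs_sub_le_of_sobolevNorm_le hab ht ENNReal.ofReal_ne_top
  exact (Metric.uniformEquicontinuous_of_continuity_modulus _ (tendsto_const_mul_rpow_zero hγ C)
    (fun _ : Unit => p) fun x y _ => hC p hp.1 hp.2.2.2 x y).uniformContinuous ()

theorem exists_extDensities (hab : a < b) (ht : 1 / 2 < t) {p : Dom a b → ℝ}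
    (hp : p ∈ densities a b t ζ D) : ∃ F ∈ extDensities a b t ζ D, F ∘ toIcc = p := by
  have hi := (isometry_toIcc (a := a) (b := b)).isUniformInducing
  have hd := denseRange_toIcc hab
  have hu := uniformContinuous_of_mem_densities hab ht hp
  let F : Icc a b →ᵇ ℝ := mkOfCompact
    ⟨(hi.isDenseInducing hd).extend p, (uniformContinuous_uniformly_extend hi hd hu).continuous⟩
  have hF : F ∘ toIcc = p := funext (uniformly_extend_of_ind hi hd hu)
  exact ⟨F, by rwa [extDensities, mem_ofPred_eq, hF], hF⟩

theorem comp_toIcc_injective (hab : a < b) :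
    Function.Injective fun F : Icc a b →ᵇ ℝ => (F ∘ toIcc : Dom a b → ℝ) := fun F G h =>
  DFunLike.coe_injective ((denseRange_toIcc hab).equalizer F.continuous G.continuous h)

theorem isClosed_extDensities : IsClosed (extDensities a b t ζ D) := by
  refine isClosed_of_closure_subset fun F hF => mem_densities_of_forall_approx fun ε hε => ?_
  obtain ⟨G, hG, hFG⟩ := Metric.mem_closure_iff.1 hF ε hε
  exact ⟨_, hG, fun x => (dist_coe_le_dist (toIcc x)).trans ((dist_comm G F).trans_lt hFG).le⟩

theorem exists_abs_le_of_mem_extDensities (hab : a < b) (ht : 1 / 2 < t) :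
    ∃ B, ∀ F ∈ extDensities a b t ζ D, ∀ y, |F y| ≤ B := by
  obtain ⟨B, hB⟩ := exists_abs_le_of_sobolevNorm_le hab ht (D := ENNReal.ofReal D)
    ENNReal.ofReal_ne_top
  exact ⟨B, fun F hF y => (denseRange_toIcc hab).induction_on y
    (isClosed_le F.continuous.abs continuous_const) (hB _ hF.1 hF.2.2.2)⟩

theorem equicontinuous_extDensities (hab : a < b) (ht : 1 / 2 < t) :
    Equicontinuous ((↑) : extDensities a b t ζ D → Icc a b → ℝ) := by
  obtain ⟨C, γ, -, hγ, hC⟩ := exists_abs_sub_le_of_sobolevNorm_le hab ht (D := ENNReal.ofReal D)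
    ENNReal.ofReal_ne_top
  refine Metric.equicontinuous_of_continuity_modulus _ (tendsto_const_mul_rpow_zero hγ C) _
    fun x y F => ?_
  have hF := F.1.continuous
  refine (denseRange_toIcc hab).induction_on₂ (p := fun x y => dist (F.1 x) (F.1 y) ≤
    C * dist x y ^ γ) (isClosed_le ?_ ?_) (hC _ F.2.1 F.2.2.2.2) x y
  · exact (hF.comp continuous_fst).dist (hF.comp continuous_snd)
  · exact continuous_const.mul (continuous_dist.rpow_const fun _ => .inr hγ.le)

theorem isCompact_extDensities (hab : a < b) (ht : 1 / 2 < t) :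
    IsCompact (extDensities a b t ζ D) := by
  obtain ⟨B, hB⟩ := exists_abs_le_of_mem_extDensities hab ht (ζ := ζ) (D := D)
  exact arzela_ascoli₂ (Icc (-B) B) isCompact_Icc _ isClosed_extDensities
    (fun F y hF => abs_le.1 (hB F hF y)) (equicontinuous_extDensities hab ht)

end Compactness

section Likelihood

variable {t ζ D : ℝ} {n : ℕ}

theorem sum_log_eq_log_prod {ι : Type*} (A : Finset ι) (u : ι → ℝ≥0∞) :
    ∑ i ∈ A, ENNReal.log (u i) = ENNReal.log (∏ i ∈ A, u i) := by
  induction A using Finset.cons_induction with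
  | empty => simp
  | cons i A hi ih => rw [Finset.sum_cons, Finset.prod_cons, ENNReal.log_mul_add, ih]

theorem logLik_le_logLik_iff (hn : 0 < n) (x : Fin n → Dom a b) {p q : Dom a b → ℝ} :
    logLik x p ≤ logLik x q ↔ ∏ i, (p (x i)).toNNReal ≤ ∏ i, (q (x i)).toNNReal := by
  have hmono : StrictMono fun z : EReal => z / ((n : ℝ) : EReal) :=
    EReal.strictMono_div_right_of_pos (EReal.coe_pos.2 (Nat.cast_pos.2 hn)) (EReal.coe_ne_top _)
  simp only [logLik, sum_log_eq_log_prod, EReal.coe_inv, ← EReal.div_eq_inv_mul]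
  rw [hmono.le_iff_le, ENNReal.log_le_log_iff]
  simp only [ENNReal.ofReal]
  exact_mod_cast Iff.rfl

theorem exists_isNPML (hab : a < b) (ht : 1 / 2 < t) (hζ : ζ ≤ (b - a)⁻¹) (hD : 0 ≤ D)
    (hDb : (b - a)⁻¹ ≤ D ^ 2) (hn : 0 < n) (x : Fin n → Dom a b) : ∃ p, IsNPML t ζ D x p := by
  obtain ⟨F₀, hF₀, -⟩ := exists_extDensities hab ht (const_mem_densities (t := t) hab hζ hD hDb)
  obtain ⟨F, hF, hmax⟩ := (isCompact_extDensities hab ht).exists_isMaxOn ⟨F₀, hF₀⟩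
    (f := fun F => ∏ i, (F (toIcc (x i))).toNNReal) (continuous_finsetProd _ fun i _ =>
      continuous_real_toNNReal.comp (continuous_eval_const _)).continuousOn
  refine ⟨F ∘ toIcc, hF, le_antisymm (le_iSup₂_of_le _ hF le_rfl) (iSup₂_le fun q hq => ?_)⟩
  obtain ⟨G, hG, rfl⟩ := exists_extDensities hab ht hq
  exact (logLik_le_logLik_iff hn x).2 (hmax hG)

theorem IsNPML.prod_le_prod (hζ : 0 ≤ ζ) (hn : 0 < n) {x : Fin n → Dom a b} {p q : Dom a b → ℝ}
    (hp : IsNPML t ζ D x p) (hq : q ∈ densities a b t ζ D) : ∏ i, q (x i) ≤ ∏ i, p (x i) := by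
  have hlik : logLik x q ≤ logLik x p := hp.2 ▸ le_iSup₂_of_le q hq le_rfl
  rw [logLik_le_logLik_iff hn, ← NNReal.coe_le_coe, NNReal.coe_prod, NNReal.coe_prod] at hlik
  simpa only [fun i => Real.coe_toNNReal _ (hζ.trans (hq.2.2.1 (x i))),
    fun i => Real.coe_toNNReal _ (hζ.trans (hp.1.2.2.1 (x i)))] using hlik

theorem sum_le_card_of_one_le_prod {ι : Type*} {A : Finset ι} {u : ι → ℝ}
    (hu : ∀ i ∈ A, u i ≤ 2) (h : 1 ≤ ∏ i ∈ A, (2 - u i)) : ∑ i ∈ A, u i ≤ A.card := by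
  have hexp : ∏ i ∈ A, (2 - u i) ≤ Real.exp (∑ i ∈ A, (1 - u i)) := by
    rw [Real.exp_sum]
    refine Finset.prod_le_prod (fun i hi => sub_nonneg.2 (hu i hi)) fun i _ => ?_
    linarith [Real.add_one_le_exp (1 - u i)]
  have hsum := Real.one_le_exp_iff.1 (h.trans hexp)
  simpa using hsum

/-- The ratio of `p` to the midpoint of `p` and `q`, which stays bounded where `q` vanishes. It is
`0` at the common zeros of `p` and `q`. -/
noncomputable def midRatio {X : Type*} (p q : X → ℝ) (x : X) : ℝ := 2 * p x / (q x + p x)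

theorem midRatio_nonneg {X : Type*} {p q : X → ℝ} {x : X} (hp : 0 ≤ p x) (hq : 0 ≤ q x) :
    0 ≤ midRatio p q x := by
  unfold midRatio
  positivity

theorem midRatio_le_two {X : Type*} {p q : X → ℝ} {x : X} (hp : 0 ≤ p x) (hq : 0 ≤ q x) :
    midRatio p q x ≤ 2 :=
  div_le_of_le_mul₀ (by positivity) two_pos.le (by linarith)

theorem measurable_midRatio {X : Type*} [MeasurableSpace X] {p q : X → ℝ} (hp : Measurable p)
    (hq : Measurable q) : Measurable (midRatio p q) := by
  unfold midRatio
  fun_prop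

theorem IsNPML.sum_midRatio_le (hζ : 0 ≤ ζ) (hn : 0 < n) {x : Fin n → Dom a b}
    {p q : Dom a b → ℝ} (hp : IsNPML t ζ D x p) (hq : q ∈ densities a b t ζ D)
    (hpos : ∀ i, 0 < q (x i)) : ∑ i, midRatio q p (x i) ≤ n := by
  have hp0 (y : Dom a b) : 0 ≤ p y := hζ.trans (hp.1.2.2.1 y)
  have hmid (i : Fin n) : 0 < ((2⁻¹ : ℝ) • (p + q)) (x i) :=
    mul_pos (by norm_num) (add_pos_of_nonneg_of_pos (hp0 _) (hpos i))
  have hratio (i : Fin n) :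
      p (x i) / ((2⁻¹ : ℝ) • (p + q)) (x i) = 2 - midRatio q p (x i) := by
    have hne : p (x i) + q (x i) ≠ 0 := (add_pos_of_nonneg_of_pos (hp0 _) (hpos i)).ne'
    simp only [midRatio, Pi.smul_apply, Pi.add_apply, smul_eq_mul]
    field_simp
    ring
  have hprod : 1 ≤ ∏ i, (2 - midRatio q p (x i)) := by
    simp only [← hratio]
    rw [Finset.prod_div_distrib, one_le_div (Finset.prod_pos fun i _ => hmid i)]
    exact hp.prod_le_prod hζ hn (midpoint_mem_densities hp.1 hq)
  simpa using sum_le_card_of_one_le_prod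
    (fun i _ => midRatio_le_two (hpos i).le (hp0 _)) hprod

end Likelihood

section UniformStrongLaw

variable {S T V E : Type*} [MeasurableSpace S] [MeasurableSpace V]
  {Pr : Measure S} {μ : Measure V} {W : ℕ → S → V}

theorem ae_tendsto_average_comp [NormedAddCommGroup E] [NormedSpace ℝ E] [CompleteSpace E]
    [MeasurableSpace E] [BorelSpace E] (hWm : ∀ i, Measurable (W i))
    (hWi : Pairwise fun i j => IndepFun (W i) (W j) Pr) (hWl : ∀ i, Pr.map (W i) = μ)
    {G : V → E} (hGm : Measurable G) (hG : Integrable G μ) :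
    ∀ᵐ e ∂Pr, Tendsto (fun n : ℕ => (n : ℝ)⁻¹ • ∑ i ∈ Finset.range n, G (W i e)) atTop
      (𝓝 (∫ v, G v ∂μ)) := by
  have hident (i : ℕ) : IdentDistrib (W i) (W 0) Pr Pr :=
    ⟨(hWm i).aemeasurable, (hWm 0).aemeasurable, (hWl i).trans (hWl 0).symm⟩
  have hint : Integrable G (Pr.map (W 0)) := hWl 0 ▸ hG
  have hlim : ∫ v, G v ∂μ = ∫ e, G (W 0 e) ∂Pr := by
    rw [← hWl 0, integral_map (hWm 0).aemeasurable hint.aestronglyMeasurable]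
  rw [hlim]
  exact strong_law_ae _ (hint.comp_measurable (hWm 0)) (fun i j hij => (hWi hij).comp hGm hGm)
    fun i => (hident i).comp hGm

variable [PseudoMetricSpace T] [CompactSpace T]

/- The restriction to a countable dense set is a continuous injection of Polish spaces, hence a
measurable embedding by the Lusin–Souslin theorem. -/
theorem measurable_of_forall_measurable_eval [MeasurableSpace C(T, ℝ)] [BorelSpace C(T, ℝ)]
    {G : V → C(T, ℝ)} (hG : ∀ τ, Measurable fun v => G v τ) : Measurable G := by
  obtain ⟨A, hAc, hAd⟩ := TopologicalSpace.exists_countable_dense T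
  have := hAc.to_subtype
  have hcont : Continuous fun (f : C(T, ℝ)) (τ : A) => f τ :=
    continuous_pi fun τ => continuous_eval_const (τ : T)
  have hinj : Function.Injective fun (f : C(T, ℝ)) (τ : A) => f τ := fun f g h =>
    DFunLike.coe_injective (f.continuous.ext_on hAd g.continuous fun τ hτ => congrFun h ⟨τ, hτ⟩)
  exact (hcont.measurableEmbedding hinj).measurable_comp_iff.1
    (measurable_pi_iff.2 fun τ => hG τ)

theorem ae_tendstoUniformly_average_of_continuous [IsFiniteMeasure μ]
    (hWm : ∀ i, Measurable (W i)) (hWi : Pairwise fun i j => IndepFun (W i) (W j) Pr)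
    (hWl : ∀ i, Pr.map (W i) = μ) {G : V → C(T, ℝ)} {C : ℝ}
    (hGm : ∀ τ, Measurable fun v => G v τ) (hGC : ∀ v τ, |G v τ| ≤ C) :
    ∀ᵐ e ∂Pr, TendstoUniformly (fun (n : ℕ) τ => (n : ℝ)⁻¹ * ∑ i ∈ Finset.range n, G (W i e) τ)
      (fun τ => ∫ v, G v τ ∂μ) atTop := by
  borelize C(T, ℝ)
  have hG := measurable_of_forall_measurable_eval hGm
  have hint : Integrable G μ := by
    refine .of_bound hG.aestronglyMeasurable (max C 0) (ae_of_all _ fun v => ?_)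
    exact (ContinuousMap.norm_le _ (le_max_right _ _)).2 fun τ => (hGC v τ).trans (le_max_left _ _)
  filter_upwards [ae_tendsto_average_comp hWm hWi hWl hG hint] with e he
  simpa [ContinuousMap.tendsto_iff_tendstoUniformly, ← ContinuousMap.integral_apply hint] using he

theorem ae_tendstoUniformly_average [IsFiniteMeasure μ]
    (hWm : ∀ i, Measurable (W i)) (hWi : Pairwise fun i j => IndepFun (W i) (W j) Pr)
    (hWl : ∀ i, Pr.map (W i) = μ) {F : V → T → ℝ} {C : ℝ}
    (hFm : ∀ τ, Measurable fun v => F v τ) (hFC : ∀ v τ, |F v τ| ≤ C)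
    (hFc : ∀ᵐ v ∂μ, Continuous (F v)) :
    ∀ᵐ e ∂Pr, TendstoUniformly (fun (n : ℕ) τ => (n : ℝ)⁻¹ * ∑ i ∈ Finset.range n, F (W i e) τ)
      (fun τ => ∫ v, F v τ ∂μ) atTop := by
  classical
  obtain ⟨N, hNμ, hNm, hN⟩ := hFc.exists_measurable_mem
  let G (v : V) : C(T, ℝ) := if hv : v ∈ N then ⟨F v, hN v hv⟩ else 0
  have hG (v : V) (τ : T) : G v τ = N.indicator (fun v => F v τ) v := by
    by_cases hv : v ∈ N <;> simp [G, hv]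
  have hGF (v : V) (hv : v ∈ N) (τ : T) : G v τ = F v τ := by
    rw [hG, indicator_of_mem hv]
  have hGC (v : V) (τ : T) : |G v τ| ≤ C := by
    rw [hG]
    exact (norm_indicator_le_norm_self (fun v => F v τ) v).trans (hFC v τ)
  have hWN : ∀ᵐ e ∂Pr, ∀ i, W i e ∈ N :=
    ae_all_iff.2 fun i => ae_of_ae_map (hWm i).aemeasurable (by rwa [hWl i])
  filter_upwards [hWN, ae_tendstoUniformly_average_of_continuous hWm hWi hWl
    (fun τ => by simpa only [hG] using (hFm τ).indicator hNm) hGC] with e heN he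
  have hint (τ : T) : ∫ v, G v τ ∂μ = ∫ v, F v τ ∂μ :=
    integral_congr_ae (mem_of_superset hNμ fun v hv => hGF v hv τ)
  simpa only [hGF _ (heN _), hint] using he

theorem eventually_forall_mem_of_tendstoUniformly {Φ : T → ℝ} (hΦ : Continuous Φ)
    {ι : Type*} {l : Filter ι} {Φs : ι → T → ℝ} (hΦs : TendstoUniformly Φs Φ l) {U : Set T}
    (hU : IsOpen U) {c : ℝ} (hc : ∀ τ, Φ τ ≤ c → τ ∈ U) :
    ∀ᶠ i in l, ∀ τ, Φs i τ ≤ c → τ ∈ U := by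
  rcases Uᶜ.eq_empty_or_nonempty with hempty | hne
  · exact .of_forall fun i τ _ => compl_empty_iff.1 hempty ▸ mem_univ τ
  obtain ⟨τ₀, hτ₀, hmin⟩ := hU.isClosed_compl.isCompact.exists_isMinOn hne hΦ.continuousOn
  have hgap : c < Φ τ₀ := lt_of_not_ge fun h => hτ₀ (hc τ₀ h)
  filter_upwards [Metric.tendstoUniformly_iff.1 hΦs _ (sub_pos.2 hgap)] with i hi τ hτ
  by_contra hτU
  have hΦτ : Φ τ₀ ≤ Φ τ := hmin hτU
  linarith [(abs_lt.1 (hi τ)).2]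

end UniformStrongLaw

section Information

variable {t ζ D : ℝ}

theorem IsDensity.integral_eq {P : Measure (Dom a b)} {p : Dom a b → ℝ} (hP : IsDensity P p)
    (g : Dom a b → ℝ) : ∫ x, g x ∂P = ∫ x, g x * p x ∂(leb a b) := by
  rw [hP.2.2, integral_withDensity_eq_integral_toReal_smul hP.1.ennreal_ofReal
    (ae_of_all _ fun x => ENNReal.ofReal_lt_top)]
  simp only [ENNReal.toReal_ofReal (hP.2.1 _), smul_eq_mul, mul_comm]

theorem IsDensity.ae_pos {P : Measure (Dom a b)} {p : Dom a b → ℝ} (hP : IsDensity P p) :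
    ∀ᵐ x ∂P, 0 < p x := by
  rw [hP.2.2, ae_withDensity_iff hP.1.ennreal_ofReal]
  exact ae_of_all _ fun x hx => ENNReal.ofReal_pos.1 (pos_iff_ne_zero.2 hx)

theorem midRatio_mul_eq {X : Type*} {p q : X → ℝ} {x : X} (hp : 0 ≤ p x) (hq : 0 ≤ q x) :
    midRatio p q x * p x - (3 / 2 * p x - 1 / 2 * q x) = (q x - p x) ^ 2 / (2 * (q x + p x)) := by
  unfold midRatio
  rcases (add_nonneg hq hp).eq_or_lt with hsum | hsum
  · rw [show p x = 0 by linarith, show q x = 0 by linarith]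
    simp
  · field_simp
    ring

theorem integrable_midRatio_mul (hζ : 0 ≤ ζ) {p q : Dom a b → ℝ} (hp : p ∈ densities a b t ζ D)
    (hq : q ∈ densities a b t ζ D) : Integrable (fun x => midRatio p q x * p x) (leb a b) := by
  have hp0 (x : Dom a b) : 0 ≤ p x := hζ.trans (hp.2.2.1 x)
  have hq0 (x : Dom a b) : 0 ≤ q x := hζ.trans (hq.2.2.1 x)
  refine (integrable_of_mem_densities hp).bdd_mul (c := 2)
    (measurable_midRatio hp.1.1.measurable hq.1.1.measurable).aestronglyMeasurable
    (ae_of_all _ fun x => ?_)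
  rw [Real.norm_of_nonneg (midRatio_nonneg (hp0 x) (hq0 x))]
  exact midRatio_le_two (hp0 x) (hq0 x)

/- The remainder in `midRatio_mul_eq` is nonnegative, and its integral is at most `1 - 1 = 0`. -/
theorem eq_of_integral_midRatio_mul_le_one (hζ : 0 ≤ ζ) {p q : Dom a b → ℝ}
    (hp : p ∈ densities a b t ζ D) (hq : q ∈ densities a b t ζ D)
    (h : ∫ x, midRatio p q x * p x ∂(leb a b) ≤ 1) : q = p := by
  have hp0 (x : Dom a b) : 0 ≤ p x := hζ.trans (hp.2.2.1 x)
  have hq0 (x : Dom a b) : 0 ≤ q x := hζ.trans (hq.2.2.1 x)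
  have hratio := integrable_midRatio_mul hζ hp hq
  have hpi := (integrable_of_mem_densities hp).const_mul (3 / 2)
  have hqi := (integrable_of_mem_densities hq).const_mul (1 / 2)
  have hdiff : Integrable (fun x => 3 / 2 * p x - 1 / 2 * q x) (leb a b) := hpi.sub hqi
  have hrem : Integrable (fun x => (q x - p x) ^ 2 / (2 * (q x + p x))) (leb a b) :=
    (hratio.sub hdiff).congr (ae_of_all _ fun x => midRatio_mul_eq (hp0 x) (hq0 x))
  have hint : ∫ x, (q x - p x) ^ 2 / (2 * (q x + p x)) ∂(leb a b) ≤ 0 := by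
    simp only [← midRatio_mul_eq (hp0 _) (hq0 _)]
    rw [integral_sub hratio hdiff, integral_sub hpi hqi, integral_const_mul,
      integral_const_mul, hp.2.1, hq.2.1]
    linarith
  have hnonneg (x : Dom a b) : 0 ≤ (q x - p x) ^ 2 / (2 * (q x + p x)) :=
    div_nonneg (sq_nonneg _) (mul_nonneg zero_le_two (add_nonneg (hq0 x) (hp0 x)))
  have hzero := (integral_eq_zero_iff_of_nonneg hnonneg hrem).1
    (hint.antisymm (integral_nonneg hnonneg))
  refine (hq.1.1.ae_eq_iff_eq (leb a b) hp.1.1).1 (hzero.mono fun x hx => ?_)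
  rcases div_eq_zero_iff.1 hx with hx | hx
  · exact sub_eq_zero.1 (pow_eq_zero_iff two_ne_zero |>.1 hx)
  · linarith [hp0 x, hq0 x]

end Information

section ParameterDependence

open scoped BoundedContinuousFunction

variable {t ζ D : ℝ} {Θ V : Type*} [PseudoMetricSpace Θ] [MeasurableSpace V] {μ : Measure V}
  [IsFiniteMeasure μ] {ρ : V → Θ → Dom a b}

theorem continuous_integral_mul_extDensities (hab : a < b) (ht : 1 / 2 < t) (G : Icc a b →ᵇ ℝ) :
    Continuous fun R : extDensities a b t ζ D => ∫ x, G (toIcc x) * R.1 (toIcc x) ∂(leb a b) := by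
  obtain ⟨B, hB⟩ := exists_abs_le_of_mem_extDensities hab ht (ζ := ζ) (D := D)
  refine continuous_of_dominated (bound := fun _ => ‖G‖ * B)
    (fun R => ((continuous_comp_toIcc G).mul (continuous_comp_toIcc R.1)).aestronglyMeasurable)
    (fun R => ae_of_all _ fun x => ?_) (integrable_const _) (ae_of_all _ fun x => ?_)
  · rw [norm_mul]
    exact mul_le_mul (G.norm_coe_le_norm _) (hB _ R.2 _) (norm_nonneg _) (norm_nonneg _)
  · exact continuous_const.mul ((continuous_eval_const _).comp continuous_subtype_val)

theorem eq_of_forall_integral_mul_eq (hab : a < b) {F G : Icc a b →ᵇ ℝ}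
    (h : ∀ H : Icc a b →ᵇ ℝ, ∫ x, H (toIcc x) * F (toIcc x) ∂(leb a b)
      = ∫ x, H (toIcc x) * G (toIcc x) ∂(leb a b)) : F = G := by
  have hmul (H K : Icc a b →ᵇ ℝ) : Integrable (fun x => H (toIcc x) * K (toIcc x)) (leb a b) :=
    integrable_of_continuous_bdd (continuous_comp_toIcc (H * K)) fun x => (H * K).norm_coe_le_norm _
  have hsq : ∫ x, (F (toIcc x) - G (toIcc x)) ^ 2 ∂(leb a b) = 0 := by
    rw [← sub_eq_zero.2 (h (F - G)), ← integral_sub (hmul _ _) (hmul _ _)]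
    refine integral_congr_ae (ae_of_all _ fun x => ?_)
    simp only [BoundedContinuousFunction.sub_apply]
    ring
  have hzero := (integral_eq_zero_iff_of_nonneg (fun x => sq_nonneg _)
    (by simpa only [pow_two, BoundedContinuousFunction.sub_apply] using hmul (F - G) (F - G))).1 hsq
  refine comp_toIcc_injective hab
    (((continuous_comp_toIcc F).ae_eq_iff_eq (leb a b) (continuous_comp_toIcc G)).1 ?_)
  exact hzero.mono fun x hx => sub_eq_zero.1 (pow_eq_zero_iff two_ne_zero |>.1 hx)

/- On the compact set `extDensities` the sup-norm topology agrees with the coarser topology of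
weak convergence. -/
theorem continuous_of_forall_continuous_integral {Y : Type*} [TopologicalSpace Y] (hab : a < b)
    (ht : 1 / 2 < t) {Q : Y → extDensities a b t ζ D}
    (hQ : ∀ G : Icc a b →ᵇ ℝ,
      Continuous fun y => ∫ x, G (toIcc x) * (Q y).1 (toIcc x) ∂(leb a b)) : Continuous Q := by
  have := isCompact_iff_compactSpace.1 (isCompact_extDensities hab ht (ζ := ζ) (D := D))
  have hcont : Continuous fun (R : extDensities a b t ζ D) (G : Icc a b →ᵇ ℝ) =>
      ∫ x, G (toIcc x) * R.1 (toIcc x) ∂(leb a b) :=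
    continuous_pi (continuous_integral_mul_extDensities hab ht)
  have hinj : Function.Injective fun (R : extDensities a b t ζ D) (G : Icc a b →ᵇ ℝ) =>
      ∫ x, G (toIcc x) * R.1 (toIcc x) ∂(leb a b) :=
    fun R R' h => Subtype.ext (eq_of_forall_integral_mul_eq hab (congrFun h))
  exact (hcont.isClosedEmbedding hinj).isInducing.continuous_iff.2 (continuous_pi hQ)

theorem continuous_of_isDensity (hab : a < b) (ht : 1 / 2 < t) {Q : Θ → extDensities a b t ζ D}
    (hρm : ∀ θ, Measurable fun v => ρ v θ) (hρc : ∀ᵐ v ∂μ, Continuous (ρ v))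
    (hρl : ∀ θ, IsDensity (μ.map fun v => ρ v θ) ((Q θ).1 ∘ toIcc)) : Continuous Q := by
  refine continuous_of_forall_continuous_integral hab ht fun G => ?_
  have hG := continuous_comp_toIcc G
  have hlaw (θ : Θ) : ∫ x, G (toIcc x) * (Q θ).1 (toIcc x) ∂(leb a b)
      = ∫ v, G (toIcc (ρ v θ)) ∂μ := by
    rw [← integral_map (hρm θ).aemeasurable hG.aestronglyMeasurable, (hρl θ).integral_eq]
    rfl
  simp only [hlaw]
  exact continuous_of_dominated (bound := fun _ => ‖G‖)
    (fun θ => (hG.measurable.comp (hρm θ)).aestronglyMeasurable)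
    (fun θ => ae_of_all _ fun v => G.norm_coe_le_norm _) (integrable_const _)
    (hρc.mono fun v hv => hG.comp hv)

end ParameterDependence

section Consistency

open scoped BoundedContinuousFunction

variable {t ζ D : ℝ} {Θ V S : Type*} [PseudoMetricSpace Θ] [MeasurableSpace V]
  [MeasurableSpace S] {μ : Measure V} {ρ : V → Θ → Dom a b}

theorem nonneg_of_mem_extDensities (hζ : 0 ≤ ζ) (R : extDensities a b t ζ D) (x : Dom a b) :
    0 ≤ R.1 (toIcc x) :=
  hζ.trans (R.2.2.2.1 x)

theorem midRatio_extDensities_mem_Icc (hζ : 0 ≤ ζ) (Q R : extDensities a b t ζ D) (x : Dom a b) :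
    midRatio Q.1 R.1 (toIcc x) ∈ Icc 0 2 :=
  have hQ := nonneg_of_mem_extDensities hζ Q x
  have hR := nonneg_of_mem_extDensities hζ R x
  ⟨midRatio_nonneg hQ hR, midRatio_le_two hQ hR⟩

theorem continuous_midRatio_extDensities (hζ : 0 ≤ ζ) {Q : Θ → extDensities a b t ζ D}
    (hQ : Continuous Q) {x : Θ → Dom a b} (hx : Continuous x)
    (hpos : ∀ θ, 0 < (Q θ).1 (toIcc (x θ))) :
    Continuous fun τ : Θ × extDensities a b t ζ D => midRatio (Q τ.1).1 τ.2.1 (toIcc (x τ.1)) := by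
  have hy : Continuous fun θ => toIcc (x θ) := isometry_toIcc.continuous.comp hx
  have hnum : Continuous fun τ : Θ × extDensities a b t ζ D => (Q τ.1).1 (toIcc (x τ.1)) :=
    ((continuous_subtype_val.comp hQ).eval hy).comp continuous_fst
  have hden : Continuous fun τ : Θ × extDensities a b t ζ D => τ.2.1 (toIcc (x τ.1)) :=
    (continuous_subtype_val.comp continuous_snd).eval (hy.comp continuous_fst)
  exact (continuous_const.mul hnum).div (hden.add hnum) fun τ =>
    (add_pos_of_nonneg_of_pos (nonneg_of_mem_extDensities hζ _ _) (hpos _)).ne'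

theorem eq_of_integral_midRatio_extDensities_le_one (hab : a < b) (hζ : 0 ≤ ζ)
    {r : V → Dom a b} (hr : Measurable r) {Q R : extDensities a b t ζ D}
    (hl : IsDensity (μ.map r) (Q.1 ∘ toIcc))
    (h : ∫ v, midRatio Q.1 R.1 (toIcc (r v)) ∂μ ≤ 1) : R = Q := by
  refine Subtype.ext (comp_toIcc_injective hab
    (eq_of_integral_midRatio_mul_le_one hζ Q.2 R.2 (le_of_eq_of_le ?_ h)))
  have hm : Measurable (midRatio (Q.1 ∘ toIcc) (R.1 ∘ toIcc) : Dom a b → ℝ) :=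
    measurable_midRatio hl.1 R.2.1.1.measurable
  rw [← hl.integral_eq, integral_map hr.aemeasurable hm.aestronglyMeasurable]
  rfl

variable {Pr : Measure S} {W : ℕ → S → V} [CompactSpace Θ] [IsFiniteMeasure μ]

theorem ae_forall_average_midRatio_le_one_imp_edist_lt (hab : a < b) (ht : 1 / 2 < t)
    (hζ : 0 ≤ ζ) (hWm : ∀ i, Measurable (W i)) (hWi : Pairwise fun i j => IndepFun (W i) (W j) Pr)
    (hWl : ∀ i, Pr.map (W i) = μ) {Q : Θ → extDensities a b t ζ D}
    (hρm : ∀ θ, Measurable fun v => ρ v θ) (hρc : ∀ᵐ v ∂μ, Continuous (ρ v))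
    (hρl : ∀ θ, IsDensity (μ.map fun v => ρ v θ) ((Q θ).1 ∘ toIcc))
    (hpos : ∀ᵐ v ∂μ, ∀ θ, 0 < (Q θ).1 (toIcc (ρ v θ))) :
    ∀ᵐ e ∂Pr, ∀ ε > 0, ∀ᶠ n : ℕ in atTop, ∀ τ : Θ × extDensities a b t ζ D,
      (n : ℝ)⁻¹ * ∑ i ∈ Finset.range n, midRatio (Q τ.1).1 τ.2.1 (toIcc (ρ (W i e) τ.1)) ≤ 1 →
        edist τ.2 (Q τ.1) < ε := by
  have := isCompact_iff_compactSpace.1 (isCompact_extDensities hab ht (ζ := ζ) (D := D))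
  have hQ := continuous_of_isDensity hab ht hρm hρc hρl
  let F (v : V) (τ : Θ × extDensities a b t ζ D) : ℝ := midRatio (Q τ.1).1 τ.2.1 (toIcc (ρ v τ.1))
  have hFm (τ : Θ × extDensities a b t ζ D) : Measurable fun v => F v τ :=
    (measurable_midRatio (continuous_comp_toIcc (Q τ.1).1).measurable
      (continuous_comp_toIcc τ.2.1).measurable).comp (hρm τ.1)
  have hFC (v : V) (τ : Θ × extDensities a b t ζ D) : |F v τ| ≤ 2 := by
    have hF := midRatio_extDensities_mem_Icc hζ (Q τ.1) τ.2 (ρ v τ.1)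
    exact (abs_of_nonneg hF.1).trans_le hF.2
  have hFc : ∀ᵐ v ∂μ, Continuous (F v) := by
    filter_upwards [hρc, hpos] with v hv hv0
    exact continuous_midRatio_extDensities hζ hQ hv hv0
  have hΦ : Continuous fun τ => ∫ v, F v τ ∂μ :=
    continuous_of_dominated (fun τ => (hFm τ).aestronglyMeasurable)
      (fun τ => ae_of_all _ fun v => hFC v τ) (integrable_const 2) hFc
  filter_upwards [ae_tendstoUniformly_average hWm hWi hWl hFm hFC hFc] with e he ε hε
  refine eventually_forall_mem_of_tendstoUniformly (U := {τ | edist τ.2 (Q τ.1) < ε}) hΦ he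
    (isOpen_lt (continuous_snd.edist (hQ.comp continuous_fst)) continuous_const) fun τ hτ => ?_
  rw [mem_ofPred_eq, eq_of_integral_midRatio_extDensities_le_one hab hζ (hρm τ.1) (hρl τ.1) hτ,
    edist_self]
  exact hε

theorem ae_forall_isNPML_edist_lt (hab : a < b) (ht : 1 / 2 < t)
    (hζ : 0 ≤ ζ) (hWm : ∀ i, Measurable (W i)) (hWi : Pairwise fun i j => IndepFun (W i) (W j) Pr)
    (hWl : ∀ i, Pr.map (W i) = μ) {Q : Θ → extDensities a b t ζ D}
    (hρm : ∀ θ, Measurable fun v => ρ v θ) (hρc : ∀ᵐ v ∂μ, Continuous (ρ v))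
    (hρl : ∀ θ, IsDensity (μ.map fun v => ρ v θ) ((Q θ).1 ∘ toIcc))
    (hpos : ∀ᵐ v ∂μ, ∀ θ, 0 < (Q θ).1 (toIcc (ρ v θ))) :
    ∀ᵐ e ∂Pr, ∀ ε > 0, ∀ᶠ n : ℕ in atTop, ∀ θ, ∀ R : extDensities a b t ζ D,
      IsNPML t ζ D (fun i : Fin n => ρ (W i e) θ) (R.1 ∘ toIcc) → edist R (Q θ) < ε := by
  have hposW : ∀ᵐ e ∂Pr, ∀ i, ∀ θ, 0 < (Q θ).1 (toIcc (ρ (W i e) θ)) :=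
    ae_all_iff.2 fun i => ae_of_ae_map (hWm i).aemeasurable (by rwa [hWl i])
  filter_upwards [hposW, ae_forall_average_midRatio_le_one_imp_edist_lt hab ht hζ hWm hWi hWl
    hρm hρc hρl hpos] with e hpos he ε hε
  filter_upwards [he ε hε, eventually_gt_atTop 0] with n hn hn0 θ R hR
  refine hn (θ, R) ?_
  rw [inv_mul_le_one₀ (Nat.cast_pos.2 hn0), ← Fin.sum_univ_eq_sum_range
    fun i => midRatio (Q θ).1 R.1 (toIcc (ρ (W i e) θ))]
  exact hR.sum_midRatio_le hζ hn0 (Q θ).2 fun i => hpos i θ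

theorem supNorm_comp_toIcc_sub_le_edist (F G : Icc a b →ᵇ ℝ) :
    supNorm (F ∘ toIcc - G ∘ toIcc : Dom a b → ℝ) ≤ edist F G := by
  refine iSup_le fun x => ?_
  have h := BoundedContinuousFunction.lipschitz_eval_const (β := ℝ) (toIcc x) F G
  simpa [edist_eq_enorm_sub] using h

theorem tendsto_iSup_nhds_zero_iff {ι κ : Type*} {l : Filter ι} {u : ι → κ → ℝ≥0∞} :
    Tendsto (fun i => ⨆ j, u i j) l (𝓝 0) ↔
      Tendsto (fun i : ι × κ => u i.1 i.2) (l ×ˢ ⊤) (𝓝 0) := by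
  simp only [ENNReal.tendsto_nhds_zero, iSup_le_iff, ← principal_univ,
    eventually_prod_principal_iff, mem_univ, forall_const]

theorem tendsto_iSup_sobolevNorm_sub (hab : a < b) {s : ℝ} (hs : 0 ≤ s) (hst : s < t)
    {ι κ : Type*} {l : Filter ι} {p q : ι → κ → Dom a b → ℝ}
    (hp : ∀ i j, p i j ∈ densities a b t ζ D) (hq : ∀ i j, q i j ∈ densities a b t ζ D)
    (h : Tendsto (fun i => ⨆ j, supNorm (p i j - q i j)) l (𝓝 0)) :
    Tendsto (fun i => ⨆ j, sobolevNorm s (p i j - q i j)) l (𝓝 0) := by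
  rw [tendsto_iSup_nhds_zero_iff] at h ⊢
  exact tendsto_sobolevNorm_sub hab ENNReal.ofReal_ne_top hs hst (fun i => (hp i.1 i.2).1)
    (fun i => (hp i.1 i.2).2.2.2) (fun i => (hq i.1 i.2).1) (fun i => (hq i.1 i.2).2.2.2) h

theorem ae_forall_isNPML_tendsto_iSup (hab : a < b) (ht : 1 / 2 < t) (hζ : 0 ≤ ζ)
    (hWm : ∀ i, Measurable (W i)) (hWi : Pairwise fun i j => IndepFun (W i) (W j) Pr)
    (hWl : ∀ i, Pr.map (W i) = μ) {pθ : Θ → Dom a b → ℝ} (hpθ : ∀ θ, pθ θ ∈ densities a b t ζ D)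
    (hρm : ∀ θ, Measurable fun v => ρ v θ) (hρc : ∀ᵐ v ∂μ, Continuous (ρ v))
    (hρl : ∀ θ, IsDensity (μ.map fun v => ρ v θ) (pθ θ))
    (hpos : ∀ᵐ v ∂μ, ∀ θ, 0 < pθ θ (ρ v θ)) :
    ∀ᵐ e ∂Pr, ∀ q : ℕ → Θ → Dom a b → ℝ,
      (∀ n, 0 < n → ∀ θ, IsNPML t ζ D (fun i : Fin n => ρ (W i e) θ) (q n θ)) →
      (∀ s, 0 ≤ s → s < t → Tendsto (fun n => ⨆ θ, sobolevNorm s (q n θ - pθ θ)) atTop (𝓝 0)) ∧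
        Tendsto (fun n => ⨆ θ, supNorm (q n θ - pθ θ)) atTop (𝓝 0) := by
  choose Q hQ hQp using fun θ => exists_extDensities hab ht (hpθ θ)
  obtain rfl : (fun θ => Q θ ∘ toIcc) = pθ := funext hQp
  filter_upwards [ae_forall_isNPML_edist_lt hab ht hζ hWm hWi hWl (Q := fun θ => ⟨Q θ, hQ θ⟩)
    hρm hρc hρl hpos] with e he q hq
  have hsup : Tendsto (fun n => ⨆ θ, supNorm (q n θ - Q θ ∘ toIcc)) atTop (𝓝 0) := by
    refine ENNReal.tendsto_nhds_zero.2 fun ε hε => ?_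
    filter_upwards [he ε hε, eventually_gt_atTop 0] with n hn hn0
    refine iSup_le fun θ => ?_
    obtain ⟨R, hR, hRq⟩ := exists_extDensities hab ht (hq n hn0 θ).1
    rw [← hRq]
    exact (supNorm_comp_toIcc_sub_le_edist R (Q θ)).trans
      (hn θ ⟨R, hR⟩ (hRq ▸ hq n hn0 θ)).le
  refine ⟨fun s hs hst => ?_, hsup⟩
  rw [← tendsto_add_atTop_iff_nat 1] at hsup ⊢
  exact tendsto_iSup_sobolevNorm_sub hab hs hst (fun n θ => (hq _ n.succ_pos θ).1)
    (fun _ => hpθ) hsup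

theorem ae_forall_isNPML_tendsto (hab : a < b) (ht : 1 / 2 < t) (hζ : 0 ≤ ζ)
    (hWm : ∀ i, Measurable (W i)) (hWi : Pairwise fun i j => IndepFun (W i) (W j) Pr)
    (hWl : ∀ i, Pr.map (W i) = μ) {r : V → Dom a b} {p : Dom a b → ℝ}
    (hp : p ∈ densities a b t ζ D) (hr : Measurable r) (hl : IsDensity (μ.map r) p) :
    ∀ᵐ e ∂Pr, ∀ q : ℕ → Dom a b → ℝ,
      (∀ n, 0 < n → IsNPML t ζ D (fun i : Fin n => r (W i e)) (q n)) →
      (∀ s, 0 ≤ s → s < t → Tendsto (fun n => sobolevNorm s (q n - p)) atTop (𝓝 0)) ∧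
        Tendsto (fun n => supNorm (q n - p)) atTop (𝓝 0) := by
  have hpos : ∀ᵐ v ∂μ, ∀ _ : Unit, 0 < p (r v) := by
    simpa using ae_of_ae_map hr.aemeasurable hl.ae_pos
  filter_upwards [ae_forall_isNPML_tendsto_iSup hab ht hζ hWm hWi hWl (fun _ : Unit => hp)
    (fun _ => hr) (ae_of_all _ fun v => continuous_const) (fun _ => hl) hpos] with e he q hq
  simpa only [ciSup_const] using he (fun n _ => q n) fun n hn _ => hq n hn

end Consistency

end NPML

theorem mainTheorem6_general
    (a b t ζ D : ℝ) (hab : a < b) (ht : 1 / 2 < t) (hζ : 0 ≤ ζ) (hζb : ζ ≤ (b - a)⁻¹)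
    (hD : 0 ≤ D) (hDb : (b - a)⁻¹ ≤ D ^ 2)
    {S : Type*} [MeasurableSpace S] (Pr : Measure S)
    (P : Measure (NPML.Dom a b)) [IsFiniteMeasure P]
    (X : ℕ → S → NPML.Dom a b) (hXm : ∀ i, Measurable (X i))
    (hXi : Pairwise fun i j => IndepFun (X i) (X j) Pr) (hXl : ∀ i, Pr.map (X i) = P)
    {Θ : Type*} [PseudoMetricSpace Θ] [CompactSpace Θ] (pθ : Θ → NPML.Dom a b → ℝ)
    {V : Type*} [MeasurableSpace V] (μ : Measure V) [IsFiniteMeasure μ]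
    (ρ : V → Θ → NPML.Dom a b) (hρm : ∀ θ, Measurable (fun v => ρ v θ))
    (hρl : ∀ θ, NPML.IsDensity (μ.map (fun v => ρ v θ)) (pθ θ))
    (W : ℕ → S → V) (hWm : ∀ i, Measurable (W i))
    (hWi : Pairwise fun i j => IndepFun (W i) (W j) Pr) (hWl : ∀ i, Pr.map (W i) = μ) :
    (∀ n : ℕ, 0 < n → ∀ x : Fin n → NPML.Dom a b, ∃ p, NPML.IsNPML t ζ D x p) ∧
    (∀ p₀ : NPML.Dom a b → ℝ, NPML.IsDensity P p₀ → p₀ ∈ NPML.densities a b t ζ D →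
      ∀ᵐ e ∂Pr, ∀ phat : ℕ → NPML.Dom a b → ℝ,
        (∀ n, 0 < n → NPML.IsNPML t ζ D (fun i : Fin n => X i e) (phat n)) →
        (∀ s, 0 ≤ s → s < t →
          Tendsto (fun n => NPML.sobolevNorm s (phat n - p₀)) atTop (𝓝 0)) ∧
        Tendsto (fun n => NPML.supNorm (phat n - p₀)) atTop (𝓝 0)) ∧
    (∀ θ : Θ, pθ θ ∈ NPML.densities a b t ζ D →
      ∀ᵐ e ∂Pr, ∀ ptilde : ℕ → NPML.Dom a b → ℝ,
        (∀ k, 0 < k → NPML.IsNPML t ζ D (fun i : Fin k => ρ (W i e) θ) (ptilde k)) →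
        (∀ s, 0 ≤ s → s < t →
          Tendsto (fun k => NPML.sobolevNorm s (ptilde k - pθ θ)) atTop (𝓝 0)) ∧
        Tendsto (fun k => NPML.supNorm (ptilde k - pθ θ)) atTop (𝓝 0)) ∧
    ((∀ θ, pθ θ ∈ NPML.densities a b t ζ D) → (∀ᵐ v ∂μ, ∀ θ, 0 < pθ θ (ρ v θ)) →
      (∀ᵐ v ∂μ, Continuous (fun θ => ρ v θ)) →
      ∀ᵐ e ∂Pr, ∀ ptilde : ℕ → Θ → NPML.Dom a b → ℝ,
        (∀ k, 0 < k → ∀ θ, NPML.IsNPML t ζ D (fun i : Fin k => ρ (W i e) θ) (ptilde k θ)) →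
        (∀ s, 0 ≤ s → s < t →
          Tendsto (fun k => ⨆ θ, NPML.sobolevNorm s (ptilde k θ - pθ θ)) atTop (𝓝 0)) ∧
        Tendsto (fun k => ⨆ θ, NPML.supNorm (ptilde k θ - pθ θ)) atTop (𝓝 0)) :=
  ⟨fun _ hn x => NPML.exists_isNPML hab ht hζb hD hDb hn x,
    fun _ hp₀ hp₀m => NPML.ae_forall_isNPML_tendsto hab ht hζ hXm hXi hXl (r := fun x => x) hp₀m
      measurable_id (by rwa [Measure.map_id']),
    fun θ hθ => NPML.ae_forall_isNPML_tendsto hab ht hζ hWm hWi hWl (r := fun v => ρ v θ) hθ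
      (hρm θ) (hρl θ),
    fun hp hpos hρc => NPML.ae_forall_isNPML_tendsto_iSup hab ht hζ hWm hWi hWl hp hρm hρc hρl
      hpos⟩

theorem mainTheorem6
    -- the interval and the constants of the non-parametric model
    (a b t ζ D : ℝ) (hab : a < b) (ht : 1 / 2 < t) (hζ : 0 ≤ ζ) (hζb : ζ < (b - a)⁻¹)
    (hD : 0 < D) (hDb : (b - a)⁻¹ < D ^ 2)
    -- the underlying probability space and the i.i.d. data with common law `P`
    {S : Type*} [MeasurableSpace S] (Pr : Measure S) [IsProbabilityMeasure Pr]
    (P : Measure (NPML.Dom a b)) [IsProbabilityMeasure P]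
    (X : ℕ → S → NPML.Dom a b) (hXm : ∀ i, Measurable (X i)) (hXi : iIndepFun X Pr)
    (hXl : ∀ i, Pr.map (X i) = P)
    -- the parametric model
    (m : ℕ) (Θ : Set (EuclideanSpace ℝ (Fin m))) (hΘ : IsCompact Θ) (hΘne : Θ.Nonempty)
    (pθ : Θ → NPML.Dom a b → ℝ)
    -- the simulation mechanism and the i.i.d. simulated variables with common law `μ`
    {V : Type*} [MeasurableSpace V] (μ : Measure V) [IsProbabilityMeasure μ]
    (ρ : V → Θ → NPML.Dom a b) (hρm : ∀ θ, Measurable (fun v => ρ v θ))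
    (hρl : ∀ θ, NPML.IsDensity (μ.map (fun v => ρ v θ)) (pθ θ))
    (W : ℕ → S → V) (hWm : ∀ i, Measurable (W i)) (hWi : iIndepFun W Pr)
    (hWl : ∀ i, Pr.map (W i) = μ) :
    -- NPML-estimators exist
    (∀ n : ℕ, 0 < n → ∀ x : Fin n → NPML.Dom a b, ∃ p, NPML.IsNPML t ζ D x p) ∧
    -- (a)
    (∀ p₀ : NPML.Dom a b → ℝ, NPML.IsDensity P p₀ → p₀ ∈ NPML.densities a b t ζ D →
      ∀ phat : (n : ℕ) → (Fin n → NPML.Dom a b) → NPML.Dom a b → ℝ,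
        (∀ n, 0 < n → ∀ x, NPML.IsNPML t ζ D x (phat n x)) →
        (∀ s, 0 ≤ s → s < t → ∀ᵐ e ∂Pr,
          Tendsto (fun n => NPML.sobolevNorm s (phat n (fun i => X i e) - p₀)) atTop (𝓝 0)) ∧
        (∀ᵐ e ∂Pr,
          Tendsto (fun n => NPML.supNorm (phat n (fun i => X i e) - p₀)) atTop (𝓝 0))) ∧
    -- (b)
    (∀ θ : Θ, pθ θ ∈ NPML.densities a b t ζ D →
      ∀ ptilde : (k : ℕ) → (Fin k → V) → NPML.Dom a b → ℝ,
        (∀ k, 0 < k → ∀ v, NPML.IsNPML t ζ D (fun i => ρ (v i) θ) (ptilde k v)) →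
        (∀ s, 0 ≤ s → s < t → ∀ᵐ e ∂Pr,
          Tendsto (fun k => NPML.sobolevNorm s (ptilde k (fun i => W i e) - pθ θ))
            atTop (𝓝 0)) ∧
        (∀ᵐ e ∂Pr,
          Tendsto (fun k => NPML.supNorm (ptilde k (fun i => W i e) - pθ θ)) atTop (𝓝 0))) ∧
    -- (c)
    ((∀ θ, pθ θ ∈ NPML.densities a b t ζ D) → (∃ c > 0, ∀ θ x, c ≤ pθ θ x) →
      (∀ v, Continuous (fun θ => ρ v θ)) →
      ∀ ptilde : (k : ℕ) → Θ → (Fin k → V) → NPML.Dom a b → ℝ,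
        (∀ k, 0 < k → ∀ θ v, NPML.IsNPML t ζ D (fun i => ρ (v i) θ) (ptilde k θ v)) →
        (∀ s, 0 ≤ s → s < t → ∀ᵐ e ∂Pr,
          Tendsto (fun k => ⨆ θ, NPML.sobolevNorm s (ptilde k θ (fun i => W i e) - pθ θ))
            atTop (𝓝 0)) ∧
        (∀ᵐ e ∂Pr,
          Tendsto (fun k => ⨆ θ, NPML.supNorm (ptilde k θ (fun i => W i e) - pθ θ))
            atTop (𝓝 0))) := by
  have : CompactSpace Θ := isCompact_iff_compactSpace.1 hΘ
  obtain ⟨hex, ha, hb, hc⟩ := mainTheorem6_general a b t ζ D hab ht hζ hζb.le hD.le hDb.le Pr P X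
    hXm (fun _ _ => hXi.indepFun) hXl pθ μ ρ hρm hρl W hWm (fun _ _ => hWi.indepFun) hWl
  have hsplit {A : ℝ → S → Prop} {B : S → Prop}
      (h : ∀ᵐ e ∂Pr, (∀ s, 0 ≤ s → s < t → A s e) ∧ B e) :
      (∀ s, 0 ≤ s → s < t → ∀ᵐ e ∂Pr, A s e) ∧ ∀ᵐ e ∂Pr, B e :=
    ⟨fun s hs hst => h.mono fun e he => he.1 s hs hst, h.mono fun e he => he.2⟩
  refine ⟨hex, fun p₀ hp₀ hp₀m phat hphat => hsplit ?_, fun θ hθ ptilde hptilde => hsplit ?_,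
    fun hp ⟨c, hc0, hpc⟩ hρc ptilde hptilde => hsplit ?_⟩
  · exact (ha p₀ hp₀ hp₀m).mono fun e he => he _ fun n hn => hphat n hn _
  · exact (hb θ hθ).mono fun e he => he _ fun k hk => hptilde k hk _
  · have hpos : ∀ᵐ v ∂μ, ∀ θ, 0 < pθ θ (ρ v θ) := ae_of_all _ fun v θ => hc0.trans_le (hpc θ _)
    exact (hc hp hpos (ae_of_all _ hρc)).mono fun e he => he _ fun k hk θ => hptilde k hk θ _
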